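/- For $k<1$ let $$K(k)=\int_0^{\pi/2}\frac{d\theta}{\sqrt{1-k\sin^2\theta}},\qquad E(k)=\int_0^{\pi/2}\sqrt{1-k\sin^2\theta}\,d\theta$$ be the complete elliptic integrals of the first and second kind, as functions of the parameter $k$ (the square of the modulus), and for $0<k<1$ put $r(k)=K(1-k)/K(k)$. For every real $r>0$ there is exactly one $k_r\in(0,1)$ with $r(k_r)=r$. The function $r(k)$ is differentiable at $k_r$; write $\{r,k\}=\frac{dr}{dk}\big|_{k=k_r}$. Then $$\{r,k\}=-\frac{\pi}{4k_r(1-k_r)K(k_r)^2}\neq 0,$$ and, with $q=e^{-\pi r}$, the series below converges and $$24\sum_{n=1}^{\infty}\frac{nq^n}{1-q^n}=1+\frac{6E(k_r)+(k_r-5)K(k_r)}{\pi k_r(1-k_r)K(k_r)\{r,k\}}.$$ -/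

import Mathlib

/-- The complete elliptic integral of the first kind as a function of the parameter `k`
(the square of the modulus): `K(k) = ∫_0^{π/2} dθ / √(1 - k sin² θ)`. -/
noncomputable def ellipticK (k : ℝ) : ℝ :=
  ∫ θ in (0 : ℝ)..(Real.pi / 2), 1 / Real.sqrt (1 - k * Real.sin θ ^ 2)

/-- The complete elliptic integral of the second kind as a function of the parameter `k`:
`E(k) = ∫_0^{π/2} √(1 - k sin² θ) dθ`. -/
noncomputable def ellipticE (k : ℝ) : ℝ :=
  ∫ θ in (0 : ℝ)..(Real.pi / 2), Real.sqrt (1 - k * Real.sin θ ^ 2)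

/-- The period ratio `r(k) = K(1 - k) / K(k)`, for `0 < k < 1`. -/
noncomputable def periodRatio (k : ℝ) : ℝ :=
  ellipticK (1 - k) / ellipticK k

open Real Set Filter Topology MeasureTheory intervalIntegral

/-! Write θ₃ = `thetaSeries q 1`, θ₄ = `thetaSeries q (-1)` and θ₂⁴ = q · (`thetaSeries q q`)⁴, and
parametrise by the nome: k = 1 - θ₄⁴/θ₃⁴ (`ellipticParam`). Passing from q to q² replaces θ₃², θ₄²
by their arithmetic and geometric means, so Gauss's invariance (`gaussIntegral_agm_step`) along q ^
2 ^ n → 0 gives K(k) = (π/2) θ₃² (`ellipticK_ellipticParam`). Poisson summation exchanges θ₂ and θ₄,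
hence k and 1 - k, under r ↦ 1/r; so K(1-k)/K(k) = r for q = e^{-πr} (`periodRatio_ellipticParam`),
which is existence. Legendre's relation (`legendreForm_eq`) makes r'(k) explicit and negative, which
is uniqueness.

The Jacobi triple product writes the theta constants as quotients of Euler products, whence q ∏ (1 -
q^j)^24 = (2K/π)^12 k (1-k)^4 / 16 (`mul_eulerFun_pow`). Take the logarithmic derivative in k along
q = e^{-π r(k)}: the left side gives -π r'(k) (1 - 24 S), with S the Lambert series, and the right
side 12 K'/K + 1/k - 4/(1-k), which is rational in k, E and K. Solving for S gives the formula
(`lambert_eq`). -/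

/-! ### Derivatives of K and E in the parameter. -/

lemma one_sub_mul_sin_sq_pos {k : ℝ} (hk : k < 1) (θ : ℝ) : 0 < 1 - k * sin θ ^ 2 := by
  rcases eq_or_ne (sin θ) 0 with h | h
  · simp [h]
  · nlinarith [sin_sq_le_one θ, sq_pos_of_ne_zero h]

lemma one_sub_le_one_sub_mul_sin_sq {k : ℝ} (hk : 0 ≤ k) (θ : ℝ) :
    1 - k ≤ 1 - k * sin θ ^ 2 := by
  nlinarith [sin_sq_le_one θ, sq_nonneg (sin θ)]

lemma continuous_sqrt_one_sub (k : ℝ) : Continuous fun θ : ℝ => √(1 - k * sin θ ^ 2) := by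
  fun_prop

lemma continuous_inv_sqrt_one_sub {k : ℝ} (hk : k < 1) :
    Continuous fun θ : ℝ => 1 / √(1 - k * sin θ ^ 2) :=
  continuous_const.div (continuous_sqrt_one_sub k)
    fun θ => (sqrt_pos.2 (one_sub_mul_sin_sq_pos hk θ)).ne'

lemma ellipticK_pos {k : ℝ} (hk : k < 1) : 0 < ellipticK k :=
  intervalIntegral_pos_of_pos ((continuous_inv_sqrt_one_sub hk).intervalIntegrable _ _)
    (fun θ => one_div_pos.2 (sqrt_pos.2 (one_sub_mul_sin_sq_pos hk θ))) (by positivity)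

lemma hasDerivAt_ellipticE_integral {k : ℝ} (hk : k ∈ Ioo (0 : ℝ) 1) :
    HasDerivAt ellipticE
      (∫ θ in (0 : ℝ)..(π / 2), -(sin θ ^ 2) / (2 * √(1 - k * sin θ ^ 2))) k := by
  obtain ⟨hk0, hk1⟩ := hk
  -- Any m strictly between k and 1 serves: for x in (0, m) the radicand stays above 1 - m, so the
  -- derivative has a constant bound.
  set m := (1 + k) / 2 with hm
  have hm1 : m < 1 := by rw [hm]; linarith
  have hkm : k < m := by rw [hm]; linarith
  refine (hasDerivAt_integral_of_dominated_loc_of_deriv_le (μ := volume) (s := Ioo 0 m)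
    (bound := fun _ => 1 / (2 * √(1 - m)))
    (F := fun x θ => √(1 - x * sin θ ^ 2))
    (F' := fun x θ => -(sin θ ^ 2) / (2 * √(1 - x * sin θ ^ 2))) (Ioo_mem_nhds hk0 hkm)
    (Eventually.of_forall fun x => (continuous_sqrt_one_sub x).aestronglyMeasurable)
    ((continuous_sqrt_one_sub k).intervalIntegrable _ _) ?_ ?_
    intervalIntegrable_const ?_).2
  · refine Continuous.aestronglyMeasurable ?_
    refine Continuous.div (by fun_prop) (by fun_prop) fun θ => ?_
    have := sqrt_pos.2 (one_sub_mul_sin_sq_pos hk1 θ)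
    positivity
  · refine Eventually.of_forall fun θ _ x hx => ?_
    have h1 : √(1 - m) ≤ √(1 - x * sin θ ^ 2) := sqrt_le_sqrt
      (by linarith [one_sub_le_one_sub_mul_sin_sq hx.1.le θ, hx.2])
    have h0 : 0 < √(1 - m) := sqrt_pos.2 (by linarith)
    rw [norm_div, norm_neg, norm_of_nonneg (sq_nonneg _), norm_of_nonneg (by positivity)]
    gcongr
    exact sin_sq_le_one θ
  · refine Eventually.of_forall fun θ _ x hx => ?_
    have hp := one_sub_mul_sin_sq_pos (hx.2.trans hm1) θ
    have h1 : HasDerivAt (fun x : ℝ => 1 - x * sin θ ^ 2) (-(sin θ ^ 2)) x := by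
      simpa using ((hasDerivAt_id x).mul_const (sin θ ^ 2)).const_sub 1
    exact h1.sqrt hp.ne'

lemma hasDerivAt_ellipticK_integral {k : ℝ} (hk : k ∈ Ioo (0 : ℝ) 1) :
    HasDerivAt ellipticK
      (∫ θ in (0 : ℝ)..(π / 2), sin θ ^ 2 / (2 * √(1 - k * sin θ ^ 2) ^ 3)) k := by
  obtain ⟨hk0, hk1⟩ := hk
  set m := (1 + k) / 2 with hm
  have hm1 : m < 1 := by rw [hm]; linarith
  have hkm : k < m := by rw [hm]; linarith
  refine (hasDerivAt_integral_of_dominated_loc_of_deriv_le (μ := volume) (s := Ioo 0 m)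
    (bound := fun _ => 1 / (2 * √(1 - m) ^ 3))
    (F := fun x θ => 1 / √(1 - x * sin θ ^ 2))
    (F' := fun x θ => sin θ ^ 2 / (2 * √(1 - x * sin θ ^ 2) ^ 3)) (Ioo_mem_nhds hk0 hkm)
    ?_ ((continuous_inv_sqrt_one_sub hk1).intervalIntegrable _ _) ?_ ?_
    intervalIntegrable_const ?_).2
  · filter_upwards [Iio_mem_nhds hk1] with x hx
    exact (continuous_inv_sqrt_one_sub hx).aestronglyMeasurable
  · refine Continuous.aestronglyMeasurable ?_
    refine Continuous.div (by fun_prop) (by fun_prop) fun θ => ?_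
    have := sqrt_pos.2 (one_sub_mul_sin_sq_pos hk1 θ)
    positivity
  · refine Eventually.of_forall fun θ _ x hx => ?_
    have h1 : √(1 - m) ≤ √(1 - x * sin θ ^ 2) := sqrt_le_sqrt
      (by linarith [one_sub_le_one_sub_mul_sin_sq hx.1.le θ, hx.2])
    have h0 : 0 < √(1 - m) := sqrt_pos.2 (by linarith)
    rw [norm_div, norm_of_nonneg (sq_nonneg _), norm_of_nonneg (by positivity)]
    gcongr
    exact sin_sq_le_one θ
  · refine Eventually.of_forall fun θ _ x hx => ?_
    have hp := one_sub_mul_sin_sq_pos (hx.2.trans hm1) θ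
    have hs := sqrt_pos.2 hp
    have h1 : HasDerivAt (fun x : ℝ => 1 - x * sin θ ^ 2) (-(sin θ ^ 2)) x := by
      simpa using ((hasDerivAt_id x).mul_const (sin θ ^ 2)).const_sub 1
    have h2 := (h1.sqrt hp.ne').inv hs.ne'
    simp only [one_div]
    refine h2.congr_deriv ?_
    field_simp

/-- With Δ = √(1 - k sin²θ), the function Δ - (1-k)/Δ³ is the derivative of k sin θ cos θ / Δ, which
vanishes at both endpoints. This is what brings E into K'. -/
lemma integral_inv_sqrt_cube {k : ℝ} (hk : k ∈ Ioo (0 : ℝ) 1) :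
    (1 - k) * ∫ θ in (0 : ℝ)..(π / 2), 1 / √(1 - k * sin θ ^ 2) ^ 3 = ellipticE k := by
  obtain ⟨hk0, hk1⟩ := hk
  have hs : ∀ θ, 0 < √(1 - k * sin θ ^ 2) := fun θ => sqrt_pos.2 (one_sub_mul_sin_sq_pos hk1 θ)
  have hc3 : Continuous fun θ : ℝ => 1 / √(1 - k * sin θ ^ 2) ^ 3 :=
    Continuous.div (by fun_prop) (by fun_prop) fun θ => (pow_pos (hs θ) 3).ne'
  have hd : ∀ θ, HasDerivAt (fun θ => k * (sin θ * cos θ / √(1 - k * sin θ ^ 2)))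
      (√(1 - k * sin θ ^ 2) - (1 - k) * (1 / √(1 - k * sin θ ^ 2) ^ 3)) θ := by
    intro θ
    have h1 : HasDerivAt (fun θ : ℝ => 1 - k * sin θ ^ 2) (-(k * (2 * sin θ * cos θ))) θ := by
      simpa using (((hasDerivAt_sin θ).pow 2).const_mul k).const_sub 1
    have h2 := (((hasDerivAt_sin θ).mul (hasDerivAt_cos θ)).div
      (h1.sqrt (one_sub_mul_sin_sq_pos hk1 θ).ne') (hs θ).ne').const_mul k
    refine h2.congr_deriv ?_
    have hsq := sq_sqrt (one_sub_mul_sin_sq_pos hk1 θ).le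
    have h0 := hs θ
    have hc : cos θ ^ 2 = 1 - sin θ ^ 2 := cos_sq' θ
    set D := √(1 - k * sin θ ^ 2)
    field_simp
    simp only [Pi.mul_apply]
    linear_combination (k * D ^ 2 + k ^ 2 * sin θ ^ 2) * hc
      + (k * (1 - 2 * sin θ ^ 2) - D ^ 2 - (1 - k * sin θ ^ 2)) * hsq
  have := integral_eq_sub_of_hasDerivAt (a := 0) (b := π / 2) (fun θ _ => hd θ)
    (((continuous_sqrt_one_sub k).sub (hc3.const_mul _)).intervalIntegrable _ _)
  rw [integral_sub ((continuous_sqrt_one_sub k).intervalIntegrable _ _)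
    ((hc3.const_mul _).intervalIntegrable _ _), intervalIntegral.integral_const_mul] at this
  simp only [cos_pi_div_two, sin_zero, mul_zero, zero_mul, zero_div, sub_zero] at this
  rw [ellipticE]
  linarith

lemma hasDerivAt_ellipticE {k : ℝ} (hk : k ∈ Ioo (0 : ℝ) 1) :
    HasDerivAt ellipticE ((ellipticE k - ellipticK k) / (2 * k)) k := by
  convert hasDerivAt_ellipticE_integral hk using 1
  rw [ellipticE, ellipticK, ← integral_sub ((continuous_sqrt_one_sub k).intervalIntegrable _ _)
    ((continuous_inv_sqrt_one_sub hk.2).intervalIntegrable _ _), ← intervalIntegral.integral_div]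
  refine integral_congr fun θ _ => ?_
  have hp := one_sub_mul_sin_sq_pos hk.2 θ
  have h0 := sqrt_pos.2 hp
  have hk0 := hk.1
  have hsq := sq_sqrt hp.le
  set D := √(1 - k * sin θ ^ 2)
  field_simp
  rw [hsq]; ring

lemma hasDerivAt_ellipticK {k : ℝ} (hk : k ∈ Ioo (0 : ℝ) 1) :
    HasDerivAt ellipticK ((ellipticE k - (1 - k) * ellipticK k) / (2 * k * (1 - k))) k := by
  convert hasDerivAt_ellipticK_integral hk using 1
  have hk0 := hk.1
  have hk1 : 0 < 1 - k := sub_pos.2 hk.2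
  have hs : ∀ θ, 0 < √(1 - k * sin θ ^ 2) := fun θ => sqrt_pos.2 (one_sub_mul_sin_sq_pos hk.2 θ)
  have hc3 : Continuous fun θ : ℝ => 1 / √(1 - k * sin θ ^ 2) ^ 3 :=
    Continuous.div (by fun_prop) (by fun_prop) fun θ => (pow_pos (hs θ) 3).ne'
  rw [← integral_inv_sqrt_cube hk, ← mul_sub, mul_comm (2 * k), mul_div_mul_left _ _ hk1.ne',
    ellipticK, ← integral_sub (hc3.intervalIntegrable _ _)
    ((continuous_inv_sqrt_one_sub hk.2).intervalIntegrable _ _), ← intervalIntegral.integral_div]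
  refine integral_congr fun θ _ => ?_
  have hsq := sq_sqrt (one_sub_mul_sin_sq_pos hk.2 θ).le
  have h0 := hs θ
  set D := √(1 - k * sin θ ^ 2)
  field_simp
  rw [hsq]; ring

/-! ### Legendre's relation and the derivative of the period ratio. -/

/-- Far from the true logarithmic growth at k = 1, but K(1-k) = O(k^{-1/2}) is all that the limit in
Legendre's relation needs. -/
lemma ellipticK_le {k : ℝ} (hk : k ∈ Ico (0 : ℝ) 1) : ellipticK k ≤ π / 2 / √(1 - k) := by
  have h0 : 0 < √(1 - k) := sqrt_pos.2 (sub_pos.2 hk.2)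
  calc ellipticK k ≤ ∫ _ in (0 : ℝ)..(π / 2), 1 / √(1 - k) := by
        refine integral_mono_on (by positivity)
          ((continuous_inv_sqrt_one_sub hk.2).intervalIntegrable _ _)
          intervalIntegrable_const fun θ _ => ?_
        exact one_div_le_one_div_of_le h0 (sqrt_le_sqrt (one_sub_le_one_sub_mul_sin_sq hk.1 θ))
    _ = π / 2 / √(1 - k) := by simp [div_eq_mul_inv]

lemma pi_div_two_le_ellipticK {k : ℝ} (hk : k ∈ Ico (0 : ℝ) 1) : π / 2 ≤ ellipticK k := by
  calc π / 2 = ∫ _ in (0 : ℝ)..(π / 2), (1 : ℝ) := by simp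
    _ ≤ ellipticK k := by
        refine integral_mono_on (by positivity) intervalIntegrable_const
          ((continuous_inv_sqrt_one_sub hk.2).intervalIntegrable _ _) fun θ _ => ?_
        rw [le_div_iff₀ (sqrt_pos.2 (one_sub_mul_sin_sq_pos hk.2 θ)), one_mul, sqrt_le_iff]
        refine ⟨zero_le_one, ?_⟩
        nlinarith [hk.1, sq_nonneg (sin θ)]

lemma ellipticK_sub_ellipticE {k : ℝ} (hk : k < 1) : ellipticK k - ellipticE k =
    ∫ θ in (0 : ℝ)..(π / 2), k * sin θ ^ 2 * (1 / √(1 - k * sin θ ^ 2)) := by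
  rw [ellipticE, ellipticK, ← integral_sub
    ((continuous_inv_sqrt_one_sub hk).intervalIntegrable _ _)
    ((continuous_sqrt_one_sub k).intervalIntegrable _ _)]
  refine integral_congr fun θ _ => ?_
  have hp := one_sub_mul_sin_sq_pos hk θ
  have h0 := sqrt_pos.2 hp
  have hsq := sq_sqrt hp.le
  set D := √(1 - k * sin θ ^ 2)
  field_simp
  rw [hsq]; ring

lemma ellipticK_sub_ellipticE_nonneg {k : ℝ} (hk : k ∈ Ico (0 : ℝ) 1) :
    0 ≤ ellipticK k - ellipticE k := by
  rw [ellipticK_sub_ellipticE hk.2]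
  refine integral_nonneg (by positivity) fun θ _ => ?_
  have := hk.1
  positivity

lemma ellipticK_sub_ellipticE_le {k : ℝ} (hk : k ∈ Ico (0 : ℝ) 1) :
    ellipticK k - ellipticE k ≤ k * ellipticK k := by
  rw [ellipticK_sub_ellipticE hk.2, ellipticK, ← intervalIntegral.integral_const_mul]
  have hc := continuous_inv_sqrt_one_sub hk.2
  have hk0 := hk.1
  refine integral_mono_on (by positivity)
    ((show Continuous _ from ((by fun_prop : Continuous fun θ : ℝ => k * sin θ ^ 2).mul
      hc)).intervalIntegrable _ _) ((hc.const_mul k).intervalIntegrable _ _) fun θ _ => ?_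
  gcongr
  exact mul_le_of_le_one_right hk0 (sin_sq_le_one θ)

lemma continuous_ellipticE : Continuous ellipticE := by
  unfold ellipticE
  refine continuous_parametric_intervalIntegral_of_continuous' (μ := volume) ?_ 0 (π / 2)
  simp only [Function.uncurry_def]
  fun_prop

lemma ellipticE_one : ellipticE 1 = 1 := by
  have : ellipticE 1 = ∫ θ in (0 : ℝ)..(π / 2), cos θ := by
    refine integral_congr fun θ hθ => ?_
    rw [uIcc_of_le (by positivity)] at hθ
    simp only [one_mul]
    rw [← cos_sq', sqrt_sq (cos_nonneg_of_mem_Icc ⟨by linarith [hθ.1, pi_pos], hθ.2⟩)]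
  rw [this, integral_cos]; simp

/-- The left side of Legendre's relation. -/
noncomputable def legendreForm (k : ℝ) : ℝ :=
  ellipticE k * ellipticK (1 - k) + ellipticE (1 - k) * ellipticK k - ellipticK k * ellipticK (1 - k)

lemma one_sub_mem_Ioo {k : ℝ} (hk : k ∈ Ioo (0 : ℝ) 1) : 1 - k ∈ Ioo (0 : ℝ) 1 :=
  ⟨sub_pos.2 hk.2, by linarith [hk.1]⟩

lemma hasDerivAt_comp_one_sub {f : ℝ → ℝ} {f' k : ℝ} (hf : HasDerivAt f f' (1 - k)) :
    HasDerivAt (fun x => f (1 - x)) (-f') k := by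
  exact hf.comp_const_sub 1 k

lemma hasDerivAt_legendreForm {k : ℝ} (hk : k ∈ Ioo (0 : ℝ) 1) :
    HasDerivAt legendreForm 0 k := by
  have hk' := one_sub_mem_Ioo hk
  have dE := hasDerivAt_ellipticE hk
  have dK := hasDerivAt_ellipticK hk
  have dE' := hasDerivAt_comp_one_sub (hasDerivAt_ellipticE hk')
  have dK' := hasDerivAt_comp_one_sub (hasDerivAt_ellipticK hk')
  refine (((dE.mul dK').add (dE'.mul dK)).sub (dK.mul dK')).congr_deriv ?_
  have h0 := hk.1.ne'
  have h1 := hk'.1.ne'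
  rw [show 1 - (1 - k) = k by ring]
  field_simp
  ring

lemma tendsto_ellipticK_zero : Tendsto ellipticK (𝓝[>] 0) (𝓝 (π / 2)) := by
  have hmem : ∀ᶠ k : ℝ in 𝓝[>] 0, k ∈ Ico (0 : ℝ) 1 := by
    filter_upwards [Ioo_mem_nhdsGT one_pos] with k hk using ⟨hk.1.le, hk.2⟩
  have hup : Tendsto (fun k : ℝ => π / 2 / √(1 - k)) (𝓝[>] 0) (𝓝 (π / 2)) := by
    have : ContinuousAt (fun k : ℝ => π / 2 / √(1 - k)) 0 :=
      ContinuousAt.div (by fun_prop) (by fun_prop) (by simp)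
    simpa using this.tendsto.mono_left nhdsWithin_le_nhds
  refine tendsto_of_tendsto_of_tendsto_of_le_of_le' tendsto_const_nhds hup ?_ ?_
  · filter_upwards [hmem] with k hk using pi_div_two_le_ellipticK hk
  · filter_upwards [hmem] with k hk using ellipticK_le hk

/-- Regroup the form as E(1-k) K(k) - (K(k) - E(k)) K(1-k). The first term tends to 1 · π/2; the
second is O(k) · O(k^{-1/2}). -/
lemma tendsto_legendreForm_zero : Tendsto legendreForm (𝓝[>] 0) (𝓝 (π / 2)) := by
  have hmain : Tendsto (fun k => ellipticE (1 - k) * ellipticK k) (𝓝[>] 0) (𝓝 (π / 2)) := by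
    have h1 : Tendsto (fun k : ℝ => ellipticE (1 - k)) (𝓝[>] 0) (𝓝 1) := by
      have : Continuous fun k : ℝ => ellipticE (1 - k) := continuous_ellipticE.comp (by fun_prop)
      simpa [ellipticE_one] using (this.tendsto 0).mono_left nhdsWithin_le_nhds
    simpa using h1.mul tendsto_ellipticK_zero
  have herr : Tendsto (fun k => (ellipticK k - ellipticE k) * ellipticK (1 - k)) (𝓝[>] 0)
      (𝓝 0) := by
    have hup : Tendsto (fun k : ℝ => √k * (ellipticK k * (π / 2))) (𝓝[>] 0) (𝓝 0) := by
      have h1 : Tendsto (fun k : ℝ => √k) (𝓝[>] 0) (𝓝 0) := by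
        simpa using (continuous_sqrt.tendsto 0).mono_left nhdsWithin_le_nhds
      simpa using h1.mul (tendsto_ellipticK_zero.mul_const (π / 2))
    refine squeeze_zero' ?_ ?_ hup
    · filter_upwards [Ioo_mem_nhdsGT one_pos] with k hk
      exact mul_nonneg (ellipticK_sub_ellipticE_nonneg ⟨hk.1.le, hk.2⟩)
        (ellipticK_pos (one_sub_mem_Ioo hk).2).le
    · filter_upwards [Ioo_mem_nhdsGT one_pos] with k hk
      have hk' := one_sub_mem_Ioo hk
      have h1 := ellipticK_sub_ellipticE_le ⟨hk.1.le, hk.2⟩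
      have h2 := ellipticK_le ⟨hk'.1.le, hk'.2⟩
      rw [show 1 - (1 - k) = k by ring] at h2
      have hs : 0 < √k := sqrt_pos.2 hk.1
      have hK := ellipticK_pos hk.2
      have hk0 := hk.1
      calc (ellipticK k - ellipticE k) * ellipticK (1 - k)
          ≤ (k * ellipticK k) * (π / 2 / √k) := by
            gcongr
            exact (ellipticK_pos hk'.2).le
        _ = √k * (ellipticK k * (π / 2)) := by
            have := sq_sqrt hk.1.le
            field_simp
            linear_combination -this
  have := hmain.sub herr
  rw [sub_zero] at this
  refine this.congr fun k => ?_
  rw [legendreForm]; ring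

/-- **Legendre's relation**. -/
theorem legendreForm_eq {k : ℝ} (hk : k ∈ Ioo (0 : ℝ) 1) : legendreForm k = π / 2 := by
  have hconst : ∀ x ∈ Ioo (0 : ℝ) 1, legendreForm x = legendreForm k := fun x hx =>
    isOpen_Ioo.is_const_of_deriv_eq_zero isPreconnected_Ioo
      (fun y hy => (hasDerivAt_legendreForm hy).differentiableAt.differentiableWithinAt)
      (fun y hy => (hasDerivAt_legendreForm hy).deriv) hx hk
  refine tendsto_nhds_unique (tendsto_const_nhds.congr' ?_) tendsto_legendreForm_zero
  filter_upwards [Ioo_mem_nhdsGT one_pos] with x hx using (hconst x hx).symm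

/-- The numerator in the quotient rule is a multiple of the Legendre form, hence constant up to the
factor 1/(k(1-k)). -/
theorem hasDerivAt_periodRatio {k : ℝ} (hk : k ∈ Ioo (0 : ℝ) 1) :
    HasDerivAt periodRatio (-π / (4 * k * (1 - k) * ellipticK k ^ 2)) k := by
  have hk' := one_sub_mem_Ioo hk
  have dK := hasDerivAt_ellipticK hk
  have dK' := hasDerivAt_comp_one_sub (hasDerivAt_ellipticK hk')
  have hK := (ellipticK_pos hk.2).ne'
  refine (dK'.div dK hK).congr_deriv ?_
  have h0 := hk.1.ne'
  have h1 := hk'.1.ne'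
  have hL := legendreForm_eq hk
  rw [legendreForm] at hL
  rw [show 1 - (1 - k) = k by ring]
  field_simp
  linear_combination (-4) * hL

theorem strictAntiOn_periodRatio : StrictAntiOn periodRatio (Ioo 0 1) := by
  refine strictAntiOn_of_deriv_neg (convex_Ioo 0 1)
    (fun k hk => (hasDerivAt_periodRatio hk).continuousAt.continuousWithinAt) fun k hk => ?_
  rw [interior_Ioo] at hk
  rw [(hasDerivAt_periodRatio hk).deriv]
  have h0 := hk.1
  have h1 := (one_sub_mem_Ioo hk).1
  have hK := ellipticK_pos hk.2
  exact div_neg_of_neg_of_pos (neg_lt_zero.2 pi_pos) (by positivity)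

/-! ### Gauss's integral and the arithmetic-geometric mean. -/

/-- Gauss's form of the complete elliptic integral of the first kind. -/
noncomputable def gaussIntegral (a b : ℝ) : ℝ :=
  ∫ θ in (0 : ℝ)..(π / 2), 1 / √(a ^ 2 * cos θ ^ 2 + b ^ 2 * sin θ ^ 2)

lemma mul_cos_sq_add_mul_sin_sq_pos {x y : ℝ} (hx : 0 < x) (hy : 0 < y) (θ : ℝ) :
    0 < x * cos θ ^ 2 + y * sin θ ^ 2 := by
  rcases eq_or_ne (sin θ) 0 with h | h
  · have := cos_sq' θ
    rw [h] at this
    simp [h, this, hx]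
  · positivity

lemma continuous_gaussIntegrand {a b : ℝ} (ha : 0 < a) (hb : 0 < b) :
    Continuous fun θ : ℝ => 1 / √(a ^ 2 * cos θ ^ 2 + b ^ 2 * sin θ ^ 2) :=
  Continuous.div (by fun_prop) (by fun_prop) fun θ =>
    (sqrt_pos.2 (mul_cos_sq_add_mul_sin_sq_pos (pow_pos ha 2) (pow_pos hb 2) θ)).ne'

/-- The amplitude in Landen's transformation: `tan (landenAngle a b φ - φ) = (b / a) * tan φ`. -/
noncomputable def landenAngle (a b φ : ℝ) : ℝ :=
  2 * φ - arctan ((a - b) * (sin φ * cos φ) / (a * cos φ ^ 2 + b * sin φ ^ 2))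

lemma sq_add_sq_landen (a b φ : ℝ) :
    (a * cos φ ^ 2 + b * sin φ ^ 2) ^ 2 + (a - b) ^ 2 * (sin φ * cos φ) ^ 2
      = a ^ 2 * cos φ ^ 2 + b ^ 2 * sin φ ^ 2 := by
  rw [mul_pow, cos_sq']; ring

lemma hasDerivAt_landenAngle {a b : ℝ} (ha : 0 < a) (hb : 0 < b) (φ : ℝ) :
    HasDerivAt (landenAngle a b)
      ((a + b) * (a * cos φ ^ 2 + b * sin φ ^ 2) / (a ^ 2 * cos φ ^ 2 + b ^ 2 * sin φ ^ 2)) φ := by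
  have hL := mul_cos_sq_add_mul_sin_sq_pos ha hb φ
  have hD := mul_cos_sq_add_mul_sin_sq_pos (pow_pos ha 2) (pow_pos hb 2) φ
  have hs := hasDerivAt_sin φ
  have hc := hasDerivAt_cos φ
  have h1 := ((hs.mul hc).const_mul (a - b)).div
    (((hc.pow 2).const_mul a).add ((hs.pow 2).const_mul b)) hL.ne'
  have h2 := ((hasDerivAt_id φ).const_mul 2).sub h1.arctan
  refine h2.congr_deriv ?_
  have e : cos φ ^ 2 = 1 - sin φ ^ 2 := cos_sq' φ
  simp only [Pi.mul_apply, Pi.add_apply, Pi.div_apply, Pi.pow_apply]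
  have h3 : 1 + ((a - b) * (sin φ * cos φ) / (a * cos φ ^ 2 + b * sin φ ^ 2)) ^ 2
      = (a ^ 2 * cos φ ^ 2 + b ^ 2 * sin φ ^ 2) / (a * cos φ ^ 2 + b * sin φ ^ 2) ^ 2 := by
    rw [← sq_add_sq_landen]; field_simp
  rw [h3, one_div_div, div_mul_div_comm, mul_comm (_ ^ 2), mul_div_mul_right _ _ (by positivity),
    eq_div_iff hD.ne', sub_mul, div_mul_cancel₀ _ hD.ne']
  have e4 : cos φ ^ 4 = (1 - sin φ ^ 2) ^ 2 := by rw [← e]; ring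
  ring_nf
  simp only [e, e4]
  ring

/-- With R² = a² cos²φ + b² sin²φ, the new angle has cosine (a cos²φ - b sin²φ)/R and sine (a + b)
sin φ cos φ / R. Together with the derivative of the angle, this turns the integrand of the averaged
pair into 2/R. -/
lemma gauss_form_landenAngle {a b : ℝ} (ha : 0 < a) (hb : 0 < b) (φ : ℝ) :
    ((a + b) / 2) ^ 2 * cos (landenAngle a b φ) ^ 2 + a * b * sin (landenAngle a b φ) ^ 2
      = ((a + b) / 2 * (a * cos φ ^ 2 + b * sin φ ^ 2)) ^ 2
        / (a ^ 2 * cos φ ^ 2 + b ^ 2 * sin φ ^ 2) := by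
  have hL := mul_cos_sq_add_mul_sin_sq_pos ha hb φ
  have hD := mul_cos_sq_add_mul_sin_sq_pos (pow_pos ha 2) (pow_pos hb 2) φ
  have e : cos φ ^ 2 = 1 - sin φ ^ 2 := cos_sq' φ
  have h3 : 1 + ((a - b) * (sin φ * cos φ) / (a * cos φ ^ 2 + b * sin φ ^ 2)) ^ 2
      = (a ^ 2 * cos φ ^ 2 + b ^ 2 * sin φ ^ 2) / (a * cos φ ^ 2 + b * sin φ ^ 2) ^ 2 := by
    rw [← sq_add_sq_landen]; field_simp
  have hR := sqrt_pos.2 hD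
  have hR2 := sq_sqrt hD.le
  have hsqrt : √(1 + ((a - b) * (sin φ * cos φ) / (a * cos φ ^ 2 + b * sin φ ^ 2)) ^ 2)
      = √(a ^ 2 * cos φ ^ 2 + b ^ 2 * sin φ ^ 2) / (a * cos φ ^ 2 + b * sin φ ^ 2) := by
    rw [h3, sqrt_div hD.le, sqrt_sq hL.le]
  have hca := cos_arctan ((a - b) * (sin φ * cos φ) / (a * cos φ ^ 2 + b * sin φ ^ 2))
  have hsa := sin_arctan ((a - b) * (sin φ * cos φ) / (a * cos φ ^ 2 + b * sin φ ^ 2))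
  rw [hsqrt, one_div_div] at hca
  rw [hsqrt, div_div_div_cancel_right₀ hL.ne'] at hsa
  have hc : cos (landenAngle a b φ)
      = (a * cos φ ^ 2 - b * sin φ ^ 2) / √(a ^ 2 * cos φ ^ 2 + b ^ 2 * sin φ ^ 2) := by
    rw [landenAngle, cos_sub, hca, hsa, sin_two_mul, cos_two_mul, mul_div_assoc', mul_div_assoc',
      ← add_div]
    congr 1
    linear_combination (2 * a * cos φ ^ 2) * e
  have hs : sin (landenAngle a b φ)
      = (a + b) * (sin φ * cos φ) / √(a ^ 2 * cos φ ^ 2 + b ^ 2 * sin φ ^ 2) := by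
    rw [landenAngle, sin_sub, hca, hsa, sin_two_mul, cos_two_mul, mul_div_assoc', mul_div_assoc',
      ← sub_div]
    congr 1
    linear_combination (2 * b * sin φ * cos φ) * e
  rw [hc, hs, div_pow (_ - _), div_pow (_ * (_ * _)), hR2, mul_div_assoc', mul_div_assoc', ← add_div]
  congr 1
  ring

lemma gaussIntegral_eq_half {a b : ℝ} (ha : 0 < a) (hb : 0 < b) :
    ∫ θ in (0 : ℝ)..π, 1 / √(a ^ 2 * cos θ ^ 2 + b ^ 2 * sin θ ^ 2) = 2 * gaussIntegral a b := by
  have hc := continuous_gaussIntegrand ha hb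
  rw [← integral_add_adjacent_intervals (hc.intervalIntegrable 0 (π / 2))
    (hc.intervalIntegrable (π / 2) π), two_mul, gaussIntegral]
  congr 1
  have := integral_comp_sub_left (a := π / 2) (b := π)
    (fun θ => 1 / √(a ^ 2 * cos θ ^ 2 + b ^ 2 * sin θ ^ 2)) π
  simp only [cos_pi_sub, sin_pi_sub, neg_sq, sub_self] at this
  rw [this, show π - π / 2 = π / 2 by ring]

/-- **Gauss's invariance** of the elliptic integral under the arithmetic-geometric step. -/
theorem gaussIntegral_agm_step {a b g : ℝ} (ha : 0 < a) (hb : 0 < b) (hg : 0 < g)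
    (hgab : g ^ 2 = a * b) : gaussIntegral ((a + b) / 2) g = gaussIntegral a b := by
  have hm : 0 < (a + b) / 2 := by positivity
  have hD : ∀ φ, 0 < a ^ 2 * cos φ ^ 2 + b ^ 2 * sin φ ^ 2 :=
    mul_cos_sq_add_mul_sin_sq_pos (pow_pos ha 2) (pow_pos hb 2)
  have hsub := integral_comp_mul_deriv (a := 0) (b := π / 2)
    (fun φ _ => hasDerivAt_landenAngle ha hb φ)
    (Continuous.continuousOn (Continuous.div (by fun_prop) (by fun_prop) fun φ => (hD φ).ne'))
    (continuous_gaussIntegrand hm hg)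
  have h0 : landenAngle a b 0 = 0 := by simp [landenAngle]
  -- The new angle covers [0, π] while φ covers [0, π/2]; by symmetry about π/2 this doubles the
  -- integral and cancels the factor 2 from the substitution.
  have h1 : landenAngle a b (π / 2) = π := by simp [landenAngle]; ring
  rw [h0, h1, gaussIntegral_eq_half hm hg] at hsub
  have h2 : 2 * gaussIntegral a b = 2 * gaussIntegral ((a + b) / 2) g := by
    rw [← hsub, gaussIntegral, ← intervalIntegral.integral_const_mul]
    refine integral_congr fun φ _ => ?_
    have hL := mul_cos_sq_add_mul_sin_sq_pos ha hb φ
    have hDφ := hD φ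
    simp only [Function.comp_apply]
    rw [hgab, gauss_form_landenAngle ha hb, sqrt_div (sq_nonneg _), sqrt_sq (by positivity)]
    have hsq := sq_sqrt hDφ.le
    have hs := sqrt_pos.2 hDφ
    rw [← hsq, sqrt_sq hs.le]
    field_simp
  linarith

lemma gaussIntegral_le {a b m : ℝ} (hm : 0 < m) (ha : m ≤ a) (hb : m ≤ b) :
    gaussIntegral a b ≤ π / 2 / m := by
  calc gaussIntegral a b ≤ ∫ _ in (0 : ℝ)..(π / 2), 1 / m := by
        refine integral_mono_on (by positivity) ((continuous_gaussIntegrand (hm.trans_le ha)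
          (hm.trans_le hb)).intervalIntegrable _ _) intervalIntegrable_const fun θ _ => ?_
        refine one_div_le_one_div_of_le hm (le_sqrt_of_sq_le ?_)
        have h1 : m ^ 2 ≤ a ^ 2 := by gcongr
        have h2 : m ^ 2 ≤ b ^ 2 := by gcongr
        nlinarith [sin_sq_add_cos_sq θ, sq_nonneg (sin θ), sq_nonneg (cos θ)]
    _ = π / 2 / m := by simp [div_eq_mul_inv]

lemma le_gaussIntegral {a b M : ℝ} (ha : 0 < a) (hb : 0 < b) (haM : a ≤ M) (hbM : b ≤ M) :
    π / 2 / M ≤ gaussIntegral a b := by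
  have hM : 0 < M := ha.trans_le haM
  calc π / 2 / M = ∫ _ in (0 : ℝ)..(π / 2), 1 / M := by simp [div_eq_mul_inv]
    _ ≤ gaussIntegral a b := by
        refine integral_mono_on (by positivity) intervalIntegrable_const
          ((continuous_gaussIntegrand ha hb).intervalIntegrable _ _) fun θ _ => ?_
        refine one_div_le_one_div_of_le
          (sqrt_pos.2 (mul_cos_sq_add_mul_sin_sq_pos (pow_pos ha 2) (pow_pos hb 2) θ))
          (sqrt_le_iff.2 ⟨hM.le, ?_⟩)
        have h1 : a ^ 2 ≤ M ^ 2 := by gcongr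
        have h2 : b ^ 2 ≤ M ^ 2 := by gcongr
        nlinarith [sin_sq_add_cos_sq θ, sq_nonneg (sin θ), sq_nonneg (cos θ)]

lemma tendsto_gaussIntegral {u v : ℕ → ℝ} (hu : ∀ n, 0 < u n) (hv : ∀ n, 0 < v n)
    (hu1 : Tendsto u atTop (𝓝 1)) (hv1 : Tendsto v atTop (𝓝 1)) :
    Tendsto (fun n => gaussIntegral (u n) (v n)) atTop (𝓝 (π / 2)) := by
  have hlo : Tendsto (fun n => π / 2 / max (u n) (v n)) atTop (𝓝 (π / 2)) := by
    simpa [Pi.div_def] using (tendsto_const_nhds (x := π / 2)).div (hu1.max hv1) (by simp)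
  have hup : Tendsto (fun n => π / 2 / min (u n) (v n)) atTop (𝓝 (π / 2)) := by
    simpa [Pi.div_def] using (tendsto_const_nhds (x := π / 2)).div (hu1.min hv1) (by simp)
  exact tendsto_of_tendsto_of_tendsto_of_le_of_le hlo hup
    (fun n => le_gaussIntegral (hu n) (hv n) (le_max_left _ _) (le_max_right _ _))
    (fun n => gaussIntegral_le (lt_min (hu n) (hv n)) (min_le_left _ _) (min_le_right _ _))

lemma ellipticK_eq_gaussIntegral {a b : ℝ} (ha : 0 < a) :
    ellipticK (1 - b ^ 2 / a ^ 2) = a * gaussIntegral a b := by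
  rw [ellipticK, gaussIntegral, ← intervalIntegral.integral_const_mul]
  refine integral_congr fun θ _ => ?_
  have : a ^ 2 * cos θ ^ 2 + b ^ 2 * sin θ ^ 2
      = a ^ 2 * (1 - (1 - b ^ 2 / a ^ 2) * sin θ ^ 2) := by
    rw [cos_sq']; field_simp; ring
  rw [this, sqrt_mul (sq_nonneg a), sqrt_sq ha.le]
  field_simp

/-! ### Euler products and Gaussian binomials. -/

/-- The finite Euler product `∏_{1 ≤ j ≤ m} (1 - q ^ j)`. -/
noncomputable def eulerProd (q : ℝ) (m : ℕ) : ℝ := ∏ j ∈ Finset.range m, (1 - q ^ (j + 1))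

/-- The logarithm of Euler's product `∏_{j ≥ 1} (1 - q ^ j)`. -/
noncomputable def eulerLog (q : ℝ) : ℝ := ∑' j : ℕ, log (1 - q ^ (j + 1))

/-- Euler's product `∏_{j ≥ 1} (1 - q ^ j)`. -/
noncomputable def eulerFun (q : ℝ) : ℝ := exp (eulerLog q)

lemma eulerFun_pos (q : ℝ) : 0 < eulerFun q := exp_pos _

lemma pow_mem_Ioo {q : ℝ} (hq : q ∈ Ioo (0 : ℝ) 1) {n : ℕ} (hn : n ≠ 0) :
    q ^ n ∈ Ioo (0 : ℝ) 1 :=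
  ⟨pow_pos hq.1 n, pow_lt_one₀ hq.1.le hq.2 hn⟩

lemma one_sub_pow_pos {q : ℝ} (hq : q ∈ Ioo (0 : ℝ) 1) (j : ℕ) : 0 < 1 - q ^ (j + 1) :=
  sub_pos.2 (pow_mem_Ioo hq j.succ_ne_zero).2

lemma eulerProd_pos {q : ℝ} (hq : q ∈ Ioo (0 : ℝ) 1) (m : ℕ) : 0 < eulerProd q m :=
  Finset.prod_pos fun j _ => one_sub_pow_pos hq j

lemma eulerProd_succ (q : ℝ) (m : ℕ) :
    eulerProd q (m + 1) = eulerProd q m * (1 - q ^ (m + 1)) :=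
  Finset.prod_range_succ _ m

lemma summable_log_one_sub_pow {q : ℝ} (hq : q ∈ Ioo (0 : ℝ) 1) :
    Summable fun j : ℕ => log (1 - q ^ (j + 1)) := by
  have h : Summable fun j : ℕ => -q ^ (j + 1) :=
    ((summable_nat_add_iff 1).2 (summable_geometric_of_lt_one hq.1.le hq.2)).neg
  simpa [sub_eq_add_neg] using summable_log_one_add_of_summable h

lemma tendsto_eulerProd {q : ℝ} (hq : q ∈ Ioo (0 : ℝ) 1) :
    Tendsto (eulerProd q) atTop (𝓝 (eulerFun q)) := by
  have h := (continuous_exp.tendsto _).comp (summable_log_one_sub_pow hq).hasSum.tendsto_sum_nat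
  refine h.congr fun m => ?_
  simp only [Function.comp_apply, exp_sum, eulerProd]
  exact Finset.prod_congr rfl fun j _ => exp_log (one_sub_pow_pos hq j)

lemma antitone_eulerProd {q : ℝ} (hq : q ∈ Ioo (0 : ℝ) 1) : Antitone (eulerProd q) :=
  antitone_nat_of_succ_le fun m => by
    rw [eulerProd_succ]
    exact mul_le_of_le_one_right (eulerProd_pos hq m).le
      (sub_le_self 1 (pow_pos hq.1 _).le)

lemma eulerFun_le_eulerProd {q : ℝ} (hq : q ∈ Ioo (0 : ℝ) 1) (m : ℕ) :
    eulerFun q ≤ eulerProd q m :=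
  (antitone_eulerProd hq).le_of_tendsto (tendsto_eulerProd hq) m

lemma eulerProd_le_one {q : ℝ} (hq : q ∈ Ioo (0 : ℝ) 1) (m : ℕ) : eulerProd q m ≤ 1 := by
  simpa [eulerProd] using antitone_eulerProd hq m.zero_le

/-- The Gaussian binomial coefficients. -/
noncomputable def gaussBinom (q : ℝ) : ℕ → ℕ → ℝ
  | _, 0 => 1
  | 0, _ + 1 => 0
  -- Truncation of `N - i` is harmless: for i > N the coefficient it multiplies is zero.
  | N + 1, i + 1 => gaussBinom q N (i + 1) + q ^ (N - i) * gaussBinom q N i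

lemma gaussBinom_zero_right (q : ℝ) (N : ℕ) : gaussBinom q N 0 = 1 := by
  cases N <;> rfl

lemma gaussBinom_succ_succ (q : ℝ) (N i : ℕ) : gaussBinom q (N + 1) (i + 1) =
    gaussBinom q N (i + 1) + q ^ (N - i) * gaussBinom q N i := rfl

lemma gaussBinom_eq_zero (q : ℝ) {N i : ℕ} (h : N < i) : gaussBinom q N i = 0 := by
  induction N generalizing i with
  | zero => obtain ⟨i, rfl⟩ := Nat.exists_eq_succ_of_ne_zero h.ne'; rfl
  | succ N ih =>
    obtain ⟨i, rfl⟩ := Nat.exists_eq_succ_of_ne_zero (Nat.ne_zero_of_lt h)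
    rw [Nat.succ_eq_add_one, gaussBinom_succ_succ, ih (by omega), ih (by omega)]
    simp

lemma gaussBinom_mul_eulerProd (q : ℝ) {N i : ℕ} (h : i ≤ N) :
    gaussBinom q N i * (eulerProd q i * eulerProd q (N - i)) = eulerProd q N := by
  induction N generalizing i with
  | zero =>
    obtain rfl : i = 0 := by omega
    simp [gaussBinom_zero_right, eulerProd]
  | succ N ih =>
    cases i with
    | zero => simp [gaussBinom_zero_right, eulerProd]
    | succ i =>
      rw [gaussBinom_succ_succ, Nat.add_sub_add_right, eulerProd_succ q N]
      have h2 := ih (i := i) (by omega)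
      rcases Nat.eq_or_lt_of_le (show i ≤ N by omega) with rfl | hi
      · rw [gaussBinom_eq_zero q i.lt_succ_self, eulerProd_succ]
        simp only [Nat.sub_self, pow_zero] at h2 ⊢
        linear_combination (1 - q ^ (i + 1)) * h2
      · have h1 := ih (i := i + 1) (by omega)
        obtain ⟨d, rfl⟩ := Nat.exists_eq_add_of_lt hi
        rw [show i + d + 1 - i = d + 1 by omega] at h2 ⊢
        rw [show i + d + 1 - (i + 1) = d by omega] at h1
        rw [eulerProd_succ q d] at h2 ⊢
        rw [eulerProd_succ q i] at h1 ⊢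
        linear_combination (1 - q ^ (d + 1)) * h1 + q ^ (d + 1) * (1 - q ^ (i + 1)) * h2

lemma gaussBinom_eq_div {q : ℝ} (hq : q ∈ Ioo (0 : ℝ) 1) {N i : ℕ} (h : i ≤ N) :
    gaussBinom q N i = eulerProd q N / (eulerProd q i * eulerProd q (N - i)) := by
  rw [eq_div_iff (mul_pos (eulerProd_pos hq _) (eulerProd_pos hq _)).ne',
    gaussBinom_mul_eulerProd q h]

/-- Uniformity in N and i supplies the dominating series for the triple product. -/
lemma abs_gaussBinom_le {q : ℝ} (hq : q ∈ Ioo (0 : ℝ) 1) {N i : ℕ} (h : i ≤ N) :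
    |gaussBinom q N i| ≤ 1 / (eulerFun q * eulerFun q) := by
  have h1 := eulerProd_pos hq N
  have h2 := eulerProd_pos hq i
  have h3 := eulerProd_pos hq (N - i)
  have h4 := eulerFun_pos q
  rw [gaussBinom_eq_div hq h, abs_of_pos (by positivity)]
  gcongr
  · exact eulerProd_le_one hq N
  · exact eulerFun_le_eulerProd hq i
  · exact eulerFun_le_eulerProd hq _

/-- The **q-binomial theorem**. -/
theorem prod_one_add_mul_pow (q x : ℝ) (N : ℕ) :
    ∏ j ∈ Finset.range N, (1 + x * q ^ j)
      = ∑ i ∈ Finset.range (N + 1), gaussBinom q N i * q ^ (i.choose 2) * x ^ i := by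
  induction N with
  | zero => simp [gaussBinom_zero_right]
  | succ N ih =>
    rw [Finset.prod_range_succ, ih, Finset.sum_range_succ' _ (N + 1)]
    simp only [gaussBinom_succ_succ, add_mul, Finset.sum_add_distrib, mul_add, mul_one]
    have h1 : ∑ i ∈ Finset.range (N + 1), gaussBinom q N (i + 1) * q ^ ((i + 1).choose 2)
        * x ^ (i + 1) + gaussBinom q (N + 1) 0 * q ^ (Nat.choose 0 2) * x ^ 0
        = ∑ i ∈ Finset.range (N + 1), gaussBinom q N i * q ^ (i.choose 2) * x ^ i := by
      rw [gaussBinom_zero_right, ← gaussBinom_zero_right q N,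
        ← Finset.sum_range_succ' (fun i => gaussBinom q N i * q ^ (i.choose 2) * x ^ i) (N + 1),
        Finset.sum_range_succ _ (N + 1), gaussBinom_eq_zero q N.lt_succ_self]
      simp
    have h2 : ∑ i ∈ Finset.range (N + 1), q ^ (N - i) * gaussBinom q N i * q ^ ((i + 1).choose 2)
        * x ^ (i + 1)
        = (∑ i ∈ Finset.range (N + 1), gaussBinom q N i * q ^ (i.choose 2) * x ^ i)
          * (x * q ^ N) := by
      rw [Finset.sum_mul]
      refine Finset.sum_congr rfl fun i hi => ?_
      have hi' : N - i + i = N := Nat.sub_add_cancel (by simpa [Nat.lt_succ_iff] using hi)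
      rw [Nat.choose_succ_succ' i 1, Nat.choose_one_right]
      calc _ = gaussBinom q N i * q ^ (i.choose 2) * x ^ i * (x * q ^ (N - i + i)) := by ring
        _ = _ := by rw [hi']
    rw [h2, ← h1]
    ring

/-- The factors on the left are 1 + z q^e with e odd from 1 - 2m to 2m - 1. Extracting z q^e from
those with e < 0 produces z^m q^{-m²}. Raising m by one adds one factor at each end. -/
lemma prod_two_mul_eq (q z : ℝ) (hq : q ≠ 0) (hz : z ≠ 0) (m : ℕ) :
    ∏ j ∈ Finset.range (2 * m), (1 + z * q ^ (1 - 2 * (m : ℤ)) * (q ^ 2) ^ j)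
      = z ^ m * q ^ (-((m : ℤ) ^ 2)) *
        ∏ j ∈ Finset.range m, ((1 + z * q ^ (2 * j + 1)) * (1 + z⁻¹ * q ^ (2 * j + 1))) := by
  induction m with
  | zero => simp
  | succ m ih =>
    rw [show 2 * (m + 1) = 2 * m + 1 + 1 by ring, Finset.prod_range_succ', Finset.prod_range_succ]
    have h1 : ∀ j : ℕ, z * q ^ (1 - 2 * ((m + 1 : ℕ) : ℤ)) * (q ^ 2) ^ (j + 1)
        = z * q ^ (1 - 2 * (m : ℤ)) * (q ^ 2) ^ j := by
      intro j
      have : q ^ (1 - 2 * (m : ℤ)) = q ^ (1 - 2 * ((m + 1 : ℕ) : ℤ)) * q ^ (2 : ℤ) := by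
        rw [← zpow_add₀ hq]; congr 1; push_cast; ring
      rw [this, zpow_ofNat]; ring
    simp only [h1]
    rw [ih, Finset.prod_range_succ]
    have h2 : z * q ^ (1 - 2 * (m : ℤ)) * (q ^ 2) ^ (2 * m) = z * q ^ (2 * m + 1) := by
      rw [← pow_mul, mul_assoc, ← zpow_natCast, ← zpow_natCast q (2 * m + 1), ← zpow_add₀ hq]
      congr 2; push_cast; ring
    have h3 : q ^ (1 - 2 * ((m + 1 : ℕ) : ℤ)) = (q ^ (2 * m + 1))⁻¹ := by
      rw [show (1 - 2 * ((m + 1 : ℕ) : ℤ)) = -((2 * m + 1 : ℕ) : ℤ) by push_cast; ring, zpow_neg,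
        zpow_natCast]
    have h4 : q ^ (-(((m + 1 : ℕ) : ℤ) ^ 2)) = q ^ (-((m : ℤ) ^ 2)) * (q ^ (2 * m + 1))⁻¹ := by
      rw [← zpow_natCast, ← zpow_neg, ← zpow_add₀ hq]; congr 1; push_cast; ring
    rw [h2, h3, h4]
    have h5 : q ^ (2 * m + 1) ≠ 0 := pow_ne_zero _ hq
    generalize q ^ (2 * m + 1) = w at *
    simp only [pow_zero, mul_one, pow_succ]
    field_simp
    ring_nf

lemma two_mul_choose_two (i : ℕ) : (2 * (i.choose 2 : ℕ) : ℤ) = i * (i - 1) := by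
  induction i with
  | zero => simp
  | succ i ih =>
    rw [Nat.choose_succ_succ' i 1, Nat.choose_one_right]
    push_cast
    linear_combination ih

/-- The finite form of the triple product identity. -/
lemma prod_eq_sum_gaussBinom (q z : ℝ) (hq : q ≠ 0) (hz : z ≠ 0) (m : ℕ) :
    ∏ j ∈ Finset.range m, ((1 + z * q ^ (2 * j + 1)) * (1 + z⁻¹ * q ^ (2 * j + 1)))
      = ∑ i ∈ Finset.range (2 * m + 1), gaussBinom (q ^ 2) (2 * m) i *
          (z ^ ((i : ℤ) - m) * q ^ (((i : ℤ) - m) ^ 2)) := by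
  have h := prod_two_mul_eq q z hq hz m
  rw [prod_one_add_mul_pow] at h
  have h0 : z ^ m * q ^ (-((m : ℤ) ^ 2)) ≠ 0 := mul_ne_zero (pow_ne_zero _ hz) (zpow_ne_zero _ hq)
  apply mul_left_cancel₀ h0
  rw [← h, Finset.mul_sum]
  refine Finset.sum_congr rfl fun i _ => ?_
  have e1 : (q ^ 2) ^ i.choose 2 = q ^ ((i : ℤ) * (i - 1)) := by
    rw [← two_mul_choose_two, ← pow_mul, ← zpow_natCast]; push_cast; rfl
  have e2 : z ^ (i : ℕ) = z ^ m * z ^ ((i : ℤ) - m) := by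
    rw [← zpow_natCast, ← zpow_natCast, ← zpow_add₀ hz]; congr 1; ring
  have e3 : q ^ ((i : ℤ) * (i - 1)) * (q ^ (1 - 2 * (m : ℤ))) ^ i
      = q ^ (-((m : ℤ) ^ 2)) * q ^ (((i : ℤ) - m) ^ 2) := by
    rw [← zpow_natCast, ← zpow_mul, ← zpow_add₀ hq, ← zpow_add₀ hq]; congr 1; ring
  rw [e1, mul_pow, e2]
  linear_combination gaussBinom (q ^ 2) (2 * m) i * z ^ m * z ^ ((i : ℤ) - m) * e3

/-! ### Theta series and the Jacobi triple product. -/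

/-- The theta series `∑_{n ∈ ℤ} z ^ n q ^ (n ^ 2)`. -/
noncomputable def thetaSeries (q z : ℝ) : ℝ := ∑' n : ℤ, z ^ n * q ^ (n ^ 2)

lemma summable_nat_theta {q : ℝ} (hq : q ∈ Ioo (0 : ℝ) 1) {z : ℝ} (hz : z ≠ 0) :
    Summable fun n : ℕ => z ^ n * q ^ (n ^ 2) := by
  have hne : ∀ n : ℕ, z ^ n * q ^ (n ^ 2) ≠ 0 := fun n =>
    mul_ne_zero (pow_ne_zero _ hz) (pow_ne_zero _ hq.1.ne')
  refine summable_of_ratio_test_tendsto_lt_one zero_lt_one (Eventually.of_forall hne) ?_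
  have h1 : Tendsto (fun n : ℕ => |z| * q * (q ^ 2) ^ n) atTop (𝓝 0) := by
    have := (tendsto_pow_atTop_nhds_zero_of_lt_one (pow_mem_Ioo hq two_ne_zero).1.le
      (pow_mem_Ioo hq two_ne_zero).2).const_mul (|z| * q)
    simpa using this
  refine h1.congr fun n => ?_
  rw [← norm_div, show z ^ (n + 1) * q ^ ((n + 1) ^ 2) / (z ^ n * q ^ (n ^ 2))
    = z * q * (q ^ 2) ^ n from ?_]
  · rw [norm_mul, norm_mul, norm_of_nonneg hq.1.le,
      norm_of_nonneg (pow_pos (pow_pos hq.1 2) n).le, norm_eq_abs]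
  · rw [div_eq_iff (hne n)]; ring

lemma summable_theta {q : ℝ} (hq : q ∈ Ioo (0 : ℝ) 1) {z : ℝ} (hz : z ≠ 0) :
    Summable fun n : ℤ => z ^ n * q ^ (n ^ 2) := by
  refine Summable.of_nat_of_neg ?_ ?_
  · refine (summable_nat_theta hq hz).congr fun n => ?_
    rw [zpow_natCast, ← Nat.cast_pow, zpow_natCast]
  · refine (summable_nat_theta hq (inv_ne_zero hz)).congr fun n => ?_
    rw [neg_sq, ← Nat.cast_pow, zpow_natCast, zpow_neg, zpow_natCast, inv_pow]

/-- The coefficients of the finite triple product, centred at zero. -/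
noncomputable def centralGaussBinom (q : ℝ) (m : ℕ) (n : ℤ) : ℝ :=
  if n ∈ Finset.Icc (-(m : ℤ)) m then gaussBinom q (2 * m) (n + m).toNat else 0

lemma prod_eq_tsum_centralGaussBinom (q z : ℝ) (hq : q ≠ 0) (hz : z ≠ 0) (m : ℕ) :
    ∏ j ∈ Finset.range m, ((1 + z * q ^ (2 * j + 1)) * (1 + z⁻¹ * q ^ (2 * j + 1)))
      = ∑' n : ℤ, centralGaussBinom (q ^ 2) m n * (z ^ n * q ^ (n ^ 2)) := by
  rw [prod_eq_sum_gaussBinom q z hq hz, tsum_eq_sum (s := Finset.Icc (-(m : ℤ)) m)]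
  · refine Finset.sum_nbij' (fun i => (i : ℤ) - m) (fun n => (n + m).toNat) ?_ ?_ ?_ ?_ ?_
    · intro i hi
      simp only [Finset.mem_range, Finset.mem_Icc] at hi ⊢
      omega
    · intro n hn
      simp only [Finset.mem_range, Finset.mem_Icc] at hn ⊢
      omega
    · intro i _
      simp
    · intro n hn
      simp only [Finset.mem_Icc] at hn
      omega
    · intro i hi
      rw [centralGaussBinom, if_pos (by simp only [Finset.mem_range, Finset.mem_Icc] at hi ⊢; omega)]
      simp
  · intro n hn
    rw [centralGaussBinom, if_neg hn, zero_mul]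

lemma abs_centralGaussBinom_le {q : ℝ} (hq : q ∈ Ioo (0 : ℝ) 1) (m : ℕ) (n : ℤ) :
    |centralGaussBinom q m n| ≤ 1 / (eulerFun q * eulerFun q) := by
  rw [centralGaussBinom]
  split_ifs with h
  · rw [Finset.mem_Icc] at h
    exact abs_gaussBinom_le hq (by omega)
  · have := eulerFun_pos q
    rw [abs_zero]; positivity

lemma tendsto_centralGaussBinom {q : ℝ} (hq : q ∈ Ioo (0 : ℝ) 1) (n : ℤ) :
    Tendsto (fun m : ℕ => centralGaussBinom q m n) atTop (𝓝 (1 / eulerFun q)) := by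
  have hE := tendsto_eulerProd hq
  have h1 : Tendsto (fun m : ℕ => 2 * m) atTop atTop :=
    tendsto_atTop_mono (fun m => Nat.le_mul_of_pos_left m two_pos) tendsto_id
  have h2 : Tendsto (fun m : ℕ => (n + m).toNat) atTop atTop :=
    tendsto_atTop.2 fun b => by
      filter_upwards [eventually_ge_atTop (b + n.natAbs)] with m hm
      omega
  have h3 : Tendsto (fun m : ℕ => 2 * m - (n + m).toNat) atTop atTop :=
    tendsto_atTop.2 fun b => by
      filter_upwards [eventually_ge_atTop (b + n.natAbs)] with m hm
      omega
  have h4 := (hE.comp h1).div ((hE.comp h2).mul (hE.comp h3))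
    (mul_pos (eulerFun_pos q) (eulerFun_pos q)).ne'
  rw [div_mul_cancel_left₀ (eulerFun_pos q).ne', ← one_div] at h4
  refine h4.congr' ?_
  filter_upwards [eventually_ge_atTop n.natAbs] with m hm
  rw [centralGaussBinom, if_pos (by rw [Finset.mem_Icc]; omega), gaussBinom_eq_div hq (by omega)]
  rfl

/-- The **Jacobi triple product identity**, with the infinite product as a limit. -/
theorem tendsto_triple_product {q : ℝ} (hq : q ∈ Ioo (0 : ℝ) 1) {z : ℝ} (hz : z ≠ 0) :
    Tendsto (fun m => ∏ j ∈ Finset.range m,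
        ((1 + z * q ^ (2 * j + 1)) * (1 + z⁻¹ * q ^ (2 * j + 1)))) atTop
      (𝓝 (thetaSeries q z / eulerFun (q ^ 2))) := by
  have hq2 := pow_mem_Ioo hq two_ne_zero
  -- Each centred coefficient tends to 1/`eulerFun (q ^ 2)`, so the limit passes inside the sum.
  have h := tendsto_tsum_of_dominated_convergence (𝓕 := atTop)
    (f := fun (m : ℕ) (n : ℤ) => centralGaussBinom (q ^ 2) m n * (z ^ n * q ^ (n ^ 2)))
    (bound := fun n : ℤ => 1 / (eulerFun (q ^ 2) * eulerFun (q ^ 2)) * ‖z ^ n * q ^ (n ^ 2)‖)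
    ((summable_theta hq hz).norm.mul_left _)
    (fun n => (tendsto_centralGaussBinom hq2 n).mul_const (z ^ n * q ^ (n ^ 2)))
    (Eventually.of_forall fun m n => by
      rw [norm_mul]
      exact mul_le_mul_of_nonneg_right (abs_centralGaussBinom_le hq2 m n) (norm_nonneg _))
  rw [tsum_mul_left, ← thetaSeries, one_div_mul_eq_div] at h
  exact h.congr fun m => (prod_eq_tsum_centralGaussBinom q z hq.1.ne' hz m).symm

/-! ### Theta constants as quotients of Euler products. -/

lemma eulerProd_two_mul (q : ℝ) (m : ℕ) : eulerProd q (2 * m) =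
    (∏ j ∈ Finset.range m, (1 - q ^ (2 * j + 1))) * eulerProd (q ^ 2) m := by
  induction m with
  | zero => simp [eulerProd]
  | succ m ih =>
    rw [show 2 * (m + 1) = 2 * m + 1 + 1 by ring, eulerProd_succ, eulerProd_succ, ih,
      Finset.prod_range_succ, eulerProd_succ]
    ring

lemma tendsto_prod_one_sub_odd {q : ℝ} (hq : q ∈ Ioo (0 : ℝ) 1) :
    Tendsto (fun m => ∏ j ∈ Finset.range m, (1 - q ^ (2 * j + 1))) atTop
      (𝓝 (eulerFun q / eulerFun (q ^ 2))) := by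
  have hq2 := pow_mem_Ioo hq two_ne_zero
  have h1 : Tendsto (fun m : ℕ => 2 * m) atTop atTop :=
    tendsto_atTop_mono (fun m => Nat.le_mul_of_pos_left m two_pos) tendsto_id
  refine (((tendsto_eulerProd hq).comp h1).div (tendsto_eulerProd hq2)
    (eulerFun_pos _).ne').congr fun m => ?_
  rw [Pi.div_apply, Function.comp_apply, eulerProd_two_mul,
    mul_div_cancel_right₀ _ (eulerProd_pos hq2 m).ne']

lemma tendsto_prod_one_add_odd {q : ℝ} (hq : q ∈ Ioo (0 : ℝ) 1) :
    Tendsto (fun m => ∏ j ∈ Finset.range m, (1 + q ^ (2 * j + 1))) atTop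
      (𝓝 (eulerFun (q ^ 2) / eulerFun (q ^ 4) / (eulerFun q / eulerFun (q ^ 2)))) := by
  have hq2 := pow_mem_Ioo hq two_ne_zero
  have h := (tendsto_prod_one_sub_odd hq2).div (tendsto_prod_one_sub_odd hq)
    (div_pos (eulerFun_pos _) (eulerFun_pos _)).ne'
  rw [← pow_mul] at h
  refine h.congr fun m => ?_
  rw [Pi.div_apply, ← Finset.prod_div_distrib]
  refine Finset.prod_congr rfl fun j _ => ?_
  rw [div_eq_iff (one_sub_pow_pos hq (2 * j)).ne']
  ring

lemma tendsto_prod_one_add_even {q : ℝ} (hq : q ∈ Ioo (0 : ℝ) 1) :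
    Tendsto (fun m => ∏ j ∈ Finset.range m, (1 + q ^ (2 * j + 2))) atTop
      (𝓝 (eulerFun (q ^ 4) / eulerFun (q ^ 2))) := by
  have hq2 := pow_mem_Ioo hq two_ne_zero
  have hq4 := pow_mem_Ioo hq four_ne_zero
  refine ((tendsto_eulerProd hq4).div (tendsto_eulerProd hq2) (eulerFun_pos _).ne').congr
    fun m => ?_
  rw [Pi.div_apply, eulerProd, eulerProd, ← Finset.prod_div_distrib]
  refine Finset.prod_congr rfl fun j _ => ?_
  rw [div_eq_iff (one_sub_pow_pos hq2 j).ne']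
  ring

lemma thetaSeries_neg_one {q : ℝ} (hq : q ∈ Ioo (0 : ℝ) 1) :
    thetaSeries q (-1) = eulerFun q ^ 2 / eulerFun (q ^ 2) := by
  have h1 := tendsto_triple_product hq (neg_ne_zero.2 one_ne_zero)
  have h2 : ∀ m, ∏ j ∈ Finset.range m, ((1 + -1 * q ^ (2 * j + 1)) * (1 + (-1)⁻¹ * q ^ (2 * j + 1)))
      = (∏ j ∈ Finset.range m, (1 - q ^ (2 * j + 1))) ^ 2 := fun m => by
    rw [← Finset.prod_pow]
    refine Finset.prod_congr rfl fun j _ => ?_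
    rw [inv_neg_one]; ring
  have h := tendsto_nhds_unique (h1.congr h2) ((tendsto_prod_one_sub_odd hq).pow 2)
  have e := eulerFun_pos (q ^ 2)
  field_simp at h ⊢
  linear_combination h

lemma thetaSeries_one {q : ℝ} (hq : q ∈ Ioo (0 : ℝ) 1) :
    thetaSeries q 1 = eulerFun (q ^ 2) ^ 5 / (eulerFun q ^ 2 * eulerFun (q ^ 4) ^ 2) := by
  have h1 := tendsto_triple_product hq one_ne_zero
  have h2 : ∀ m, ∏ j ∈ Finset.range m, ((1 + 1 * q ^ (2 * j + 1)) * (1 + 1⁻¹ * q ^ (2 * j + 1)))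
      = (∏ j ∈ Finset.range m, (1 + q ^ (2 * j + 1))) ^ 2 := fun m => by
    rw [← Finset.prod_pow]
    refine Finset.prod_congr rfl fun j _ => ?_
    rw [inv_one]; ring
  have h := tendsto_nhds_unique (h1.congr h2) ((tendsto_prod_one_add_odd hq).pow 2)
  have e := eulerFun_pos (q ^ 2)
  have e1 := eulerFun_pos q
  have e4 := eulerFun_pos (q ^ 4)
  field_simp at h ⊢
  linear_combination h

lemma thetaSeries_self {q : ℝ} (hq : q ∈ Ioo (0 : ℝ) 1) :
    thetaSeries q q = 2 * eulerFun (q ^ 4) ^ 2 / eulerFun (q ^ 2) := by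
  -- With z = q the factors containing z⁻¹ start at 1 + q⁰ = 2; using m + 1 factors lets this one be
  -- split off.
  have h1 := (tendsto_add_atTop_iff_nat 1).2 (tendsto_triple_product hq hq.1.ne')
  have hE := tendsto_prod_one_add_even hq
  have h2 : ∀ m, ∏ j ∈ Finset.range (m + 1),
        ((1 + q * q ^ (2 * j + 1)) * (1 + q⁻¹ * q ^ (2 * j + 1)))
      = (∏ j ∈ Finset.range (m + 1), (1 + q ^ (2 * j + 2)))
        * (2 * ∏ j ∈ Finset.range m, (1 + q ^ (2 * j + 2))) := fun m => by
    have : 2 * ∏ j ∈ Finset.range m, (1 + q ^ (2 * j + 2))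
        = ∏ j ∈ Finset.range (m + 1), (1 + q⁻¹ * q ^ (2 * j + 1)) := by
      rw [Finset.prod_range_succ', mul_comm]
      have hq0 := hq.1.ne'
      congr 1
      · refine Finset.prod_congr rfl fun j _ => ?_
        rw [show 2 * (j + 1) + 1 = 2 * j + 2 + 1 by ring, pow_succ q (2 * j + 2), mul_comm (q⁻¹),
          mul_inv_cancel_right₀ hq0]
      · simp [hq0]; norm_num
    rw [this, ← Finset.prod_mul_distrib]
    refine Finset.prod_congr rfl fun j _ => ?_
    ring
  have h := tendsto_nhds_unique (h1.congr h2)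
    (((tendsto_add_atTop_iff_nat 1).2 hE).mul (hE.const_mul 2))
  have e := eulerFun_pos (q ^ 2)
  field_simp at h ⊢
  linear_combination h

lemma thetaSeries_one_pos {q : ℝ} (hq : q ∈ Ioo (0 : ℝ) 1) : 0 < thetaSeries q 1 := by
  have e := eulerFun_pos (q ^ 2)
  have e1 := eulerFun_pos q
  have e4 := eulerFun_pos (q ^ 4)
  rw [thetaSeries_one hq]; positivity

lemma thetaSeries_neg_one_pos {q : ℝ} (hq : q ∈ Ioo (0 : ℝ) 1) : 0 < thetaSeries q (-1) := by
  have e := eulerFun_pos (q ^ 2)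
  have e1 := eulerFun_pos q
  rw [thetaSeries_neg_one hq]; positivity

lemma thetaSeries_self_pos {q : ℝ} (hq : q ∈ Ioo (0 : ℝ) 1) : 0 < thetaSeries q q := by
  have e := eulerFun_pos (q ^ 2)
  have e4 := eulerFun_pos (q ^ 4)
  rw [thetaSeries_self hq]; positivity

/-! ### Doubling the nome, and Jacobi's quartic identity. -/

/-- The decomposition of `ℤ × ℤ` by the parity of the coordinate sum. -/
def parityEquiv : (ℤ × ℤ) ⊕ (ℤ × ℤ) ≃ ℤ × ℤ where
  toFun := Sum.elim (fun p => (p.1 + p.2, p.1 - p.2)) (fun p => (p.1 + p.2 + 1, p.1 - p.2))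
  invFun p := if (p.1 + p.2) % 2 = 0 then Sum.inl ((p.1 + p.2) / 2, (p.1 - p.2) / 2)
    else Sum.inr ((p.1 + p.2 - 1) / 2, (p.1 - p.2 - 1) / 2)
  left_inv := by
    rintro (⟨a, b⟩ | ⟨a, b⟩)
    · change (if (a + b + (a - b)) % 2 = 0 then
        Sum.inl ((a + b + (a - b)) / 2, (a + b - (a - b)) / 2) else _) = _
      rw [if_pos (by omega)]
      congr 2 <;> omega
    · change (if (a + b + 1 + (a - b)) % 2 = 0 then _ else
        Sum.inr ((a + b + 1 + (a - b) - 1) / 2, (a + b + 1 - (a - b) - 1) / 2)) = _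
      rw [if_neg (by omega)]
      congr 2 <;> omega
  right_inv := by
    rintro ⟨m, n⟩
    simp only
    split_ifs with h
    · simp only [Sum.elim_inl, Prod.mk.injEq]; omega
    · simp only [Sum.elim_inr, Prod.mk.injEq]; omega

lemma tsum_parity {f : ℤ × ℤ → ℝ} (hf : Summable f) : ∑' p, f p =
    ∑' p : ℤ × ℤ, f (p.1 + p.2, p.1 - p.2) + ∑' p : ℤ × ℤ, f (p.1 + p.2 + 1, p.1 - p.2) := by
  have h := (parityEquiv.summable_iff (f := f)).2 hf
  rw [← parityEquiv.tsum_eq f]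
  exact Summable.tsum_sum (h.comp_injective Sum.inl_injective) (h.comp_injective Sum.inr_injective)

/-- Split the double sum over (m, n) by the parity of m + n. On (a+b, a-b), m² + n² = 2(a² + b²) and
z^{m+n} = 1; on (a+b+1, a-b), m² + n² = 2(a² + a + b² + b) + 1 and z^{m+n} = z. -/
lemma thetaSeries_sq {q : ℝ} (hq : q ∈ Ioo (0 : ℝ) 1) {z : ℝ} (hz : z ^ 2 = 1) :
    thetaSeries q z ^ 2 = thetaSeries (q ^ 2) 1 ^ 2 + z * (q * thetaSeries (q ^ 2) (q ^ 2) ^ 2) := by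
  have hz0 : z ≠ 0 := by rintro rfl; norm_num at hz
  have hq0 := hq.1.ne'
  have hq2 := pow_mem_Ioo hq two_ne_zero
  have hS := (summable_theta hq hz0).norm
  have hS1 := (summable_theta hq2 one_ne_zero).norm
  have hS2 := (summable_theta hq2 hq2.1.ne').norm
  have hzz : ∀ n : ℤ, z ^ (2 * n) = 1 := fun n => by
    rw [zpow_mul, zpow_ofNat, hz, one_zpow]
  simp only [sq (thetaSeries _ _)]
  simp only [thetaSeries]
  rw [tsum_mul_tsum_of_summable_norm hS hS, tsum_mul_tsum_of_summable_norm hS1 hS1,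
    tsum_mul_tsum_of_summable_norm hS2 hS2, tsum_parity (summable_mul_of_summable_norm hS hS),
    ← mul_assoc, ← tsum_mul_left]
  have e2 : ∀ n : ℤ, (q ^ 2) ^ n = q ^ (2 * n) := fun n => by rw [zpow_mul, zpow_ofNat]
  congr 1
  · refine tsum_congr fun p => ?_
    rw [one_zpow, one_zpow, one_mul, one_mul, e2, e2, mul_mul_mul_comm, ← zpow_add₀ hz0,
      ← zpow_add₀ hq0, ← zpow_add₀ hq0, show p.1 + p.2 + (p.1 - p.2) = 2 * p.1 by ring, hzz, one_mul]
    congr 1; ring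
  · refine tsum_congr fun p => ?_
    rw [e2, e2, e2, e2, mul_mul_mul_comm, ← zpow_add₀ hz0, ← zpow_add₀ hq0, ← zpow_add₀ hq0,
      ← zpow_add₀ hq0, ← zpow_add₀ hq0,
      show p.1 + p.2 + 1 + (p.1 - p.2) = 2 * p.1 + 1 by ring, zpow_add₀ hz0, hzz, one_mul, zpow_one,
      mul_assoc]
    congr 1
    rw [← zpow_one_add₀ hq0]
    congr 1; ring

lemma thetaSeries_mul {q : ℝ} (hq : q ∈ Ioo (0 : ℝ) 1) :
    thetaSeries q 1 * thetaSeries q (-1) = thetaSeries (q ^ 2) (-1) ^ 2 := by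
  have hq2 := pow_mem_Ioo hq two_ne_zero
  rw [thetaSeries_one hq, thetaSeries_neg_one hq, thetaSeries_neg_one hq2, ← pow_mul]
  norm_num
  have e := eulerFun_pos (q ^ 2)
  have e1 := eulerFun_pos q
  have e4 := eulerFun_pos (q ^ 4)
  field_simp

/-- **Jacobi's quartic identity** between the theta constants. -/
theorem thetaSeries_pow_four {q : ℝ} (hq : q ∈ Ioo (0 : ℝ) 1) :
    thetaSeries q 1 ^ 4 - thetaSeries q (-1) ^ 4 = q * thetaSeries q q ^ 4 := by
  have hq2 := pow_mem_Ioo hq two_ne_zero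
  have h1 := thetaSeries_sq hq (z := 1) (by norm_num)
  have h2 := thetaSeries_sq hq (z := -1) (by norm_num)
  -- The duplication formula 2 θ₂(q²) θ₃(q²) = θ₂(q)² without its powers of q, read off from the
  -- Euler products.
  have h3 : 2 * (thetaSeries (q ^ 2) 1 * thetaSeries (q ^ 2) (q ^ 2)) = thetaSeries q q ^ 2 := by
    rw [thetaSeries_one hq2, thetaSeries_self hq2, thetaSeries_self hq, ← pow_mul, ← pow_mul]
    norm_num
    have e := eulerFun_pos (q ^ 2)
    have e8 := eulerFun_pos (q ^ 8)
    have e4 := eulerFun_pos (q ^ 4)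
    field_simp
  have h4 : thetaSeries q 1 ^ 4 - thetaSeries q (-1) ^ 4
      = (thetaSeries q 1 ^ 2) ^ 2 - (thetaSeries q (-1) ^ 2) ^ 2 := by ring
  rw [h4, h1, h2, show thetaSeries q q ^ 4 = (thetaSeries q q ^ 2) ^ 2 by ring, ← h3]
  ring

/-! ### K in terms of theta constants. -/

lemma gaussIntegral_theta_sq {q : ℝ} (hq : q ∈ Ioo (0 : ℝ) 1) :
    gaussIntegral (thetaSeries (q ^ 2) 1 ^ 2) (thetaSeries (q ^ 2) (-1) ^ 2)
      = gaussIntegral (thetaSeries q 1 ^ 2) (thetaSeries q (-1) ^ 2) := by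
  have hq2 := pow_mem_Ioo hq two_ne_zero
  have h1 := thetaSeries_sq hq (z := 1) (by norm_num)
  have h2 := thetaSeries_sq hq (z := -1) (by norm_num)
  have h3 : thetaSeries (q ^ 2) 1 ^ 2 = (thetaSeries q 1 ^ 2 + thetaSeries q (-1) ^ 2) / 2 := by
    rw [h1, h2]; ring
  rw [h3]
  refine gaussIntegral_agm_step (pow_pos (thetaSeries_one_pos hq) 2)
    (pow_pos (thetaSeries_neg_one_pos hq) 2) (pow_pos (thetaSeries_neg_one_pos hq2) 2) ?_
  rw [← thetaSeries_mul hq]; ring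

lemma gaussIntegral_theta_two_pow {q : ℝ} (hq : q ∈ Ioo (0 : ℝ) 1) (n : ℕ) :
    gaussIntegral (thetaSeries (q ^ 2 ^ n) 1 ^ 2) (thetaSeries (q ^ 2 ^ n) (-1) ^ 2)
      = gaussIntegral (thetaSeries q 1 ^ 2) (thetaSeries q (-1) ^ 2) := by
  induction n with
  | zero => simp
  | succ n ih =>
    rw [← ih, ← gaussIntegral_theta_sq (pow_mem_Ioo hq (pow_ne_zero n two_ne_zero)), ← pow_mul,
      ← pow_succ]

lemma tendsto_thetaSeries_two_pow {q : ℝ} (hq : q ∈ Ioo (0 : ℝ) 1) {z : ℝ} (hz : |z| = 1) :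
    Tendsto (fun n : ℕ => thetaSeries (q ^ 2 ^ n) z) atTop (𝓝 1) := by
  have hq0 : Tendsto (fun n : ℕ => q ^ 2 ^ n) atTop (𝓝 0) :=
    (tendsto_pow_atTop_nhds_zero_of_lt_one hq.1.le hq.2).comp
      (tendsto_pow_atTop_atTop_of_one_lt one_lt_two)
  have hsq : ∀ k : ℤ, k ^ 2 = ((k.natAbs ^ 2 : ℕ) : ℤ) := fun k => by simp
  have h := tendsto_tsum_of_dominated_convergence (𝓕 := atTop)
    (f := fun (n : ℕ) (k : ℤ) => z ^ k * (q ^ 2 ^ n) ^ (k ^ 2))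
    (g := fun k : ℤ => if k = 0 then (1 : ℝ) else 0)
    (bound := fun k : ℤ => 1 ^ k * q ^ (k ^ 2)) (summable_theta hq one_ne_zero)
    (fun k => by
      split_ifs with hk
      · simp [hk]
      · have h1 := (hq0.pow (k.natAbs ^ 2)).const_mul (z ^ k)
        rw [zero_pow (by simpa using hk), mul_zero] at h1
        refine h1.congr fun n => ?_
        rw [hsq, zpow_natCast])
    (Eventually.of_forall fun n k => by
      rw [norm_mul, norm_zpow, norm_eq_abs, hz, hsq, zpow_natCast, zpow_natCast, norm_pow,
        norm_of_nonneg (pow_pos hq.1 _).le]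
      have h0 := hq.1.le
      gcongr
      exact pow_le_of_le_one h0 hq.2.le (pow_ne_zero n two_ne_zero))
  rwa [tsum_ite_eq] at h

/-- The elliptic parameter with nome `q`. -/
noncomputable def ellipticParam (q : ℝ) : ℝ := 1 - thetaSeries q (-1) ^ 4 / thetaSeries q 1 ^ 4

lemma one_sub_ellipticParam (q : ℝ) :
    1 - ellipticParam q = thetaSeries q (-1) ^ 4 / thetaSeries q 1 ^ 4 := sub_sub_cancel _ _

lemma ellipticParam_eq {q : ℝ} (hq : q ∈ Ioo (0 : ℝ) 1) :
    ellipticParam q = q * thetaSeries q q ^ 4 / thetaSeries q 1 ^ 4 := by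
  have h := thetaSeries_one_pos hq
  rw [ellipticParam, ← thetaSeries_pow_four hq, sub_div, div_self (by positivity)]

lemma ellipticParam_mem {q : ℝ} (hq : q ∈ Ioo (0 : ℝ) 1) : ellipticParam q ∈ Ioo (0 : ℝ) 1 := by
  have h1 := thetaSeries_one_pos hq
  have h2 := thetaSeries_neg_one_pos hq
  have h3 := thetaSeries_self_pos hq
  have h0 := hq.1
  constructor
  · rw [ellipticParam_eq hq]; positivity
  · rw [← sub_pos, one_sub_ellipticParam]; positivity

/-- The Gauss integral of (θ₃², θ₄²) is unchanged along q ^ 2 ^ n, where both entries tend to 1, so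
it equals π/2. -/
theorem ellipticK_ellipticParam {q : ℝ} (hq : q ∈ Ioo (0 : ℝ) 1) :
    ellipticK (ellipticParam q) = π / 2 * thetaSeries q 1 ^ 2 := by
  have hpos : ∀ n : ℕ, q ^ 2 ^ n ∈ Ioo (0 : ℝ) 1 := fun n =>
    pow_mem_Ioo hq (pow_ne_zero n two_ne_zero)
  have h := tendsto_gaussIntegral (u := fun n => thetaSeries (q ^ 2 ^ n) 1 ^ 2)
    (v := fun n => thetaSeries (q ^ 2 ^ n) (-1) ^ 2)
    (fun n => pow_pos (thetaSeries_one_pos (hpos n)) 2)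
    (fun n => pow_pos (thetaSeries_neg_one_pos (hpos n)) 2)
    (by simpa using (tendsto_thetaSeries_two_pow hq (z := 1) (by simp)).pow 2)
    (by simpa using (tendsto_thetaSeries_two_pow hq (z := -1) (by simp)).pow 2)
  simp only [gaussIntegral_theta_two_pow hq] at h
  have h1 := tendsto_nhds_unique tendsto_const_nhds h
  have h2 := ellipticK_eq_gaussIntegral (b := thetaSeries q (-1) ^ 2)
    (pow_pos (thetaSeries_one_pos hq) 2)
  rw [h1, ← pow_mul, ← pow_mul] at h2
  rw [ellipticParam, h2, mul_comm]

/-! ### Inversion of the nome by Poisson summation. -/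

lemma exp_zpow (x : ℝ) (n : ℤ) : exp x ^ n = exp (n * x) := by
  rw [← rpow_intCast, ← exp_mul, mul_comm]

lemma exp_neg_pi_mul_mem {r : ℝ} (hr : 0 < r) : exp (-π * r) ∈ Ioo (0 : ℝ) 1 :=
  ⟨exp_pos _, exp_lt_one_iff.2 (by nlinarith [pi_pos])⟩

lemma thetaSeries_one_inv {r : ℝ} (hr : 0 < r) :
    thetaSeries (exp (-π * r⁻¹)) 1 = √r * thetaSeries (exp (-π * r)) 1 := by
  have h : ∀ a : ℝ, thetaSeries (exp (-π * a)) 1 = ∑' n : ℤ, exp (-π * a * (n : ℝ) ^ 2) := by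
    intro a
    refine tsum_congr fun n => ?_
    rw [one_zpow, one_mul, exp_zpow]
    push_cast
    ring_nf
  rw [h, h, Real.tsum_exp_neg_mul_int_sq hr, ← sqrt_eq_rpow, ← mul_assoc, one_div,
    mul_inv_cancel₀ (sqrt_pos.2 hr).ne', one_mul]
  simp only [div_eq_mul_inv]

lemma thetaSeries_self_inv {r : ℝ} (hr : 0 < r) :
    exp (-π * r⁻¹ / 4) * thetaSeries (exp (-π * r⁻¹)) (exp (-π * r⁻¹))
      = √r * thetaSeries (exp (-π * r)) (-1) := by
  -- The linear term i/2 gives the phase e^{πin} = (-1)^n on one side and shifts n by -1/2 on the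
  -- other. After n ↦ -n, (n + 1/2)² = n² + n + 1/4 yields `thetaSeries` at z = q and the factor
  -- `exp (-π * r⁻¹ / 4)`.
  have h := Complex.tsum_exp_neg_quadratic (a := (r : ℂ)) (by simpa using hr) (Complex.I / 2)
  have hL : (∑' n : ℤ, Complex.exp (-π * r * n ^ 2 + 2 * π * (Complex.I / 2) * n))
      = (thetaSeries (exp (-π * r)) (-1) : ℝ) := by
    rw [thetaSeries, Complex.ofReal_tsum]
    refine tsum_congr fun n => ?_
    rw [Complex.exp_add, show (2 * π * (Complex.I / 2) * n : ℂ) = n * (π * Complex.I) by ring,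
      Complex.exp_int_mul, Complex.exp_pi_mul_I, exp_zpow, mul_comm]
    push_cast
    congr 2
    ring
  have hR : (∑' n : ℤ, Complex.exp (-π / r * (n + Complex.I * (Complex.I / 2)) ^ 2))
      = ((exp (-π * r⁻¹ / 4) * thetaSeries (exp (-π * r⁻¹)) (exp (-π * r⁻¹)) : ℝ) : ℂ) := by
    rw [thetaSeries, ← tsum_mul_left, Complex.ofReal_tsum, ← (Equiv.neg ℤ).tsum_eq]
    refine tsum_congr fun n => ?_
    rw [exp_zpow, exp_zpow, ← exp_add, ← exp_add]
    push_cast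
    congr 1
    simp only [Equiv.neg_apply]
    push_cast
    rw [show Complex.I * (Complex.I / 2) = -1 / 2 by rw [← mul_div_assoc, Complex.I_mul_I]]
    ring
  rw [hL, hR, show (1 / 2 : ℂ) = ((1 / 2 : ℝ) : ℂ) by push_cast; rfl, ← Complex.ofReal_cpow hr.le,
    ← sqrt_eq_rpow] at h
  have h' : thetaSeries (exp (-π * r)) (-1) = 1 / √r *
      (exp (-π * r⁻¹ / 4) * thetaSeries (exp (-π * r⁻¹)) (exp (-π * r⁻¹))) := by
    exact_mod_cast h
  rw [h', ← mul_assoc, mul_one_div_cancel (sqrt_pos.2 hr).ne', one_mul]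

lemma ellipticParam_inv {r : ℝ} (hr : 0 < r) :
    ellipticParam (exp (-π * r⁻¹)) = 1 - ellipticParam (exp (-π * r)) := by
  have hq := exp_neg_pi_mul_mem (inv_pos.2 hr)
  have h3 := thetaSeries_one_pos (exp_neg_pi_mul_mem hr)
  have hs := sqrt_pos.2 hr
  rw [ellipticParam_eq hq, one_sub_ellipticParam, thetaSeries_one_inv hr]
  have h1 : exp (-π * r⁻¹) * thetaSeries (exp (-π * r⁻¹)) (exp (-π * r⁻¹)) ^ 4
      = (√r * thetaSeries (exp (-π * r)) (-1)) ^ 4 := by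
    rw [← thetaSeries_self_inv hr, mul_pow, ← exp_nat_mul]
    congr 2
    push_cast; ring
  rw [h1, mul_pow, mul_pow, mul_div_mul_left _ _ (pow_pos hs 4).ne']

theorem periodRatio_ellipticParam {r : ℝ} (hr : 0 < r) :
    periodRatio (ellipticParam (exp (-π * r))) = r := by
  have hq := exp_neg_pi_mul_mem hr
  have hq' := exp_neg_pi_mul_mem (inv_pos.2 hr)
  have h3 := thetaSeries_one_pos hq
  rw [periodRatio, ← ellipticParam_inv hr, ellipticK_ellipticParam hq, ellipticK_ellipticParam hq',
    thetaSeries_one_inv hr, mul_pow, sq_sqrt hr.le]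
  generalize thetaSeries (exp (-π * r)) 1 = t at h3
  field_simp

lemma periodRatio_pos {k : ℝ} (hk : k ∈ Ioo (0 : ℝ) 1) : 0 < periodRatio k :=
  div_pos (ellipticK_pos (one_sub_mem_Ioo hk).2) (ellipticK_pos hk.2)

/-- Injectivity of the period ratio turns its right inverse into a two-sided one. -/
lemma ellipticParam_periodRatio {k : ℝ} (hk : k ∈ Ioo (0 : ℝ) 1) :
    ellipticParam (exp (-π * periodRatio k)) = k :=
  strictAntiOn_periodRatio.injOn (ellipticParam_mem (exp_neg_pi_mul_mem (periodRatio_pos hk))) hk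
    (periodRatio_ellipticParam (periodRatio_pos hk))

/-! ### The discriminant product and the Lambert series. -/

/-- The discriminant product in terms of the elliptic parameter. -/
theorem mul_eulerFun_pow {q : ℝ} (hq : q ∈ Ioo (0 : ℝ) 1) :
    q * eulerFun q ^ 24 = (2 * ellipticK (ellipticParam q) / π) ^ 12 * ellipticParam q
      * (1 - ellipticParam q) ^ 4 / 16 := by
  have hπ := pi_pos
  rw [ellipticK_ellipticParam hq, one_sub_ellipticParam, ellipticParam_eq hq,
    show 2 * (π / 2 * thetaSeries q 1 ^ 2) / π = thetaSeries q 1 ^ 2 by field_simp,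
    thetaSeries_one hq, thetaSeries_neg_one hq, thetaSeries_self hq]
  have e := eulerFun_pos (q ^ 2)
  have e1 := eulerFun_pos q
  have e4 := eulerFun_pos (q ^ 4)
  field_simp
  norm_num

lemma eulerLog_identity {k : ℝ} (hk : k ∈ Ioo (0 : ℝ) 1) :
    -π * periodRatio k + 24 * eulerLog (exp (-π * periodRatio k))
      = 12 * log (ellipticK k) + log k + 4 * log (1 - k) + (12 * log (2 / π) - log 16) := by
  have h := mul_eulerFun_pow (exp_neg_pi_mul_mem (periodRatio_pos hk))
  rw [ellipticParam_periodRatio hk] at h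
  have hK := (ellipticK_pos hk.2).ne'
  have h0 := hk.1.ne'
  have h1 := (one_sub_mem_Ioo hk).1.ne'
  have hπ : (2 / π : ℝ) ≠ 0 := by positivity
  have hlog := congrArg log h
  rw [mul_div_right_comm 2 _ π, mul_pow, eulerFun, ← exp_nat_mul, ← exp_add, log_exp,
    log_div (by positivity) (by norm_num), log_mul (by positivity) (by positivity),
    log_mul (by positivity) (by positivity), log_mul (by positivity) (by positivity),
    log_pow, log_pow, log_pow] at hlog
  push_cast at hlog
  linarith

lemma summable_lambert {q : ℝ} (hq : q ∈ Ioo (0 : ℝ) 1) :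
    Summable fun n : ℕ => ((n : ℝ) + 1) * q ^ (n + 1) / (1 - q ^ (n + 1)) := by
  have h1 : Summable fun n : ℕ => ((n : ℝ) + 1) * q ^ (n + 1) := by
    have := summable_pow_mul_geometric_of_norm_lt_one 1 (r := q)
      (by rw [norm_of_nonneg hq.1.le]; exact hq.2)
    have := (summable_nat_add_iff 1).2 this
    simpa using this
  have hq1 : 0 < 1 - q := sub_pos.2 hq.2
  have hq0 := hq.1
  refine Summable.of_nonneg_of_le (fun n => ?_) (fun n => ?_) (h1.div_const (1 - q))
  · have := one_sub_pow_pos hq n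
    positivity
  · gcongr
    exact pow_le_of_le_one hq.1.le hq.2.le n.succ_ne_zero

lemma hasDerivAt_eulerLog {q : ℝ} (hq : q ∈ Ioo (0 : ℝ) 1) :
    HasDerivAt eulerLog (∑' n : ℕ, -(((n : ℝ) + 1) * q ^ n) / (1 - q ^ (n + 1))) q := by
  -- On (0, ρ) the termwise derivatives are dominated by (n + 1) ρ^n / (1 - ρ).
  obtain ⟨ρ, hqρ, hρ1⟩ := exists_between hq.2
  have hρ : ρ ∈ Ioo (0 : ℝ) 1 := ⟨hq.1.trans hqρ, hρ1⟩
  have hρ1' : 0 < 1 - ρ := sub_pos.2 hρ1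
  have hu : Summable fun n : ℕ => ((n : ℝ) + 1) * ρ ^ n / (1 - ρ) := by
    refine Summable.div_const ?_ _
    have := summable_pow_mul_geometric_of_norm_lt_one 1 (r := ρ)
      (by rw [norm_of_nonneg hρ.1.le]; exact hρ.2)
    have h2 := this.add (summable_geometric_of_lt_one hρ.1.le hρ.2)
    refine h2.congr fun n => ?_
    ring
  refine hasDerivAt_tsum_of_isPreconnected (t := Ioo 0 ρ) hu isOpen_Ioo isPreconnected_Ioo
    (g := fun (n : ℕ) y => log (1 - y ^ (n + 1)))
    (g' := fun (n : ℕ) y => -(((n : ℝ) + 1) * y ^ n) / (1 - y ^ (n + 1)))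
    (fun n y hy => ?_) (fun n y hy => ?_) (y₀ := q) ⟨hq.1, hqρ⟩ (summable_log_one_sub_pow hq)
    ⟨hq.1, hqρ⟩
  · have hp := one_sub_pow_pos ⟨hy.1, hy.2.trans hρ1⟩ n
    have h1 : HasDerivAt (fun y : ℝ => 1 - y ^ (n + 1)) (-(((n : ℝ) + 1) * y ^ n)) y := by
      simpa using (hasDerivAt_pow (n + 1) y).const_sub 1
    exact h1.log hp.ne'
  · have hp := one_sub_pow_pos ⟨hy.1, hy.2.trans hρ1⟩ n
    have hy0 := hy.1
    have hyρ := hy.2.le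
    have hρ0 := hρ.1
    rw [norm_div, norm_neg, norm_of_nonneg (by positivity), norm_of_nonneg hp.le]
    gcongr
    exact (pow_le_of_le_one hy0.le (hyρ.trans hρ1.le) n.succ_ne_zero).trans hyρ

lemma mul_deriv_eulerLog (q : ℝ) :
    q * ∑' n : ℕ, -(((n : ℝ) + 1) * q ^ n) / (1 - q ^ (n + 1))
      = -∑' n : ℕ, ((n : ℝ) + 1) * q ^ (n + 1) / (1 - q ^ (n + 1)) := by
  rw [← tsum_mul_left, ← tsum_neg]
  refine tsum_congr fun n => ?_
  ring

theorem lambert_eq {k : ℝ} (hk : k ∈ Ioo (0 : ℝ) 1) {q : ℝ} (hq : q = exp (-π * periodRatio k)) :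
    24 * ∑' n : ℕ, ((n : ℝ) + 1) * q ^ (n + 1) / (1 - q ^ (n + 1))
      = 1 - 4 * ellipticK k * (6 * ellipticE k + (k - 5) * ellipticK k) / π ^ 2 := by
  have hqm := exp_neg_pi_mul_mem (periodRatio_pos hk)
  have hr := (hasDerivAt_periodRatio hk).const_mul (-π)
  have hL := hr.add (((hasDerivAt_eulerLog hqm).comp k hr.exp).const_mul 24)
  have hK := ellipticK_pos hk.2
  have h0 := hk.1
  have h1 := (one_sub_mem_Ioo hk).1
  have dlog1 : HasDerivAt (fun x : ℝ => log (1 - x)) (-1 / (1 - k)) k :=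
    ((hasDerivAt_id k).const_sub 1).log h1.ne'
  have hR := (((((hasDerivAt_ellipticK hk).log hK.ne').const_mul 12).add
    (hasDerivAt_log h0.ne')).add (dlog1.const_mul 4)).add_const (12 * log (2 / π) - log 16)
  -- Both sides of `eulerLog_identity` are differentiated; uniqueness of the derivative gives an
  -- equation linear in the Lambert series.
  have heq := (hL.congr_of_eventuallyEq (f₁ := fun x => 12 * log (ellipticK x) + log x
      + 4 * log (1 - x) + (12 * log (2 / π) - log 16)) (by
    filter_upwards [Ioo_mem_nhds hk.1 hk.2] with x hx
    exact (eulerLog_identity hx).symm)).unique hR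
  have hS := mul_deriv_eulerLog (exp (-π * periodRatio k))
  rw [← hq] at heq hS
  have hq0 : q ≠ 0 := hq ▸ (exp_pos _).ne'
  set S := ∑' n : ℕ, ((n : ℝ) + 1) * q ^ (n + 1) / (1 - q ^ (n + 1))
  rw [mul_comm, ← eq_div_iff hq0] at hS
  rw [hS] at heq
  have hπ := pi_pos
  field_simp at heq ⊢
  linear_combination (-1 / 2 : ℝ) * heq

theorem proposition8 (r : ℝ) (hr : 0 < r) :
    (∃! k : ℝ, k ∈ Set.Ioo (0 : ℝ) 1 ∧ periodRatio k = r) ∧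
    ∀ k ∈ Set.Ioo (0 : ℝ) 1, periodRatio k = r →
      ∀ q : ℝ, q = Real.exp (-Real.pi * r) →
        HasDerivAt periodRatio (-Real.pi / (4 * k * (1 - k) * ellipticK k ^ 2)) k ∧
        deriv periodRatio k ≠ 0 ∧
        Summable (fun n : ℕ => ((n : ℝ) + 1) * q ^ (n + 1) / (1 - q ^ (n + 1))) ∧
        24 * ∑' n : ℕ, ((n : ℝ) + 1) * q ^ (n + 1) / (1 - q ^ (n + 1)) =
          1 + (6 * ellipticE k + (k - 5) * ellipticK k) /
            (Real.pi * k * (1 - k) * ellipticK k * deriv periodRatio k) := by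
  refine ⟨⟨ellipticParam (exp (-π * r)), ⟨ellipticParam_mem (exp_neg_pi_mul_mem hr),
    periodRatio_ellipticParam hr⟩, fun k hk => ?_⟩, fun k hk hkr q hq => ?_⟩
  · rw [← hk.2, ellipticParam_periodRatio hk.1]
  · have hd := hasDerivAt_periodRatio hk
    have hK := ellipticK_pos hk.2
    have h0 := hk.1
    have h1 := (one_sub_mem_Ioo hk).1
    have hπ := pi_pos
    refine ⟨hd, ?_, ?_, ?_⟩
    · rw [hd.deriv]
      exact div_ne_zero (neg_ne_zero.2 hπ.ne') (by positivity)
    · exact summable_lambert (hq ▸ exp_neg_pi_mul_mem hr)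
    -- Inserting r' makes the stated denominator -π²/(4K), matching `lambert_eq`.
    · rw [lambert_eq hk (hkr ▸ hq), hd.deriv]
      field_simp
      ring
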